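/- For integers $1\le k\le n$ let $f:[n]\to[k]$ be a uniformly random surjection and let $\Pi$ be a uniformly random partition of the set $[n]$ into $k$ non-empty blocks. Below, $n=n_m$ and $k=k_m$ are arbitrary sequences of positive integers with $k\le n$, and limits are taken as $m\to\infty$. (1) If $n/k^5\to\infty$, then the probability that $|f^{-1}(i)|=|f^{-1}(j)|$ for some $i<j$ tends to $0$, and so does the probability that $\Pi$ has two different blocks of the same size. (2) If $n/k^5\to 0$, then both of these probabilities tend to $1$. (3) If $n\ge\binom{k+1}{2}$ and $k\to\infty$, then the expected number of pairs $i<j$ with $|f^{-1}(i)|=|f^{-1}(j)|$, and likewise the expected number of unordered pairs of different blocks of $\Pi$ of the same size, is $$(1+o(1))\,\frac{k^2}{4}\sqrt{\frac{k}{\pi n}}.$$ (4) For $i<j$ and $1\le t\le n$ let $A_{ij}(t)$ be the event $|f^{-1}(i)|=|f^{-1}(j)|=t$. Consider the denominator of the Chung--Erdős second-moment bound for the family of these events, $$D=\sum_{a}P(A_a)+\sum_{a\ne b}P(A_a\cap A_b),$$ where $a,b$ run over the indices $((i,j),t)$ and the second sum is over ordered pairs, and let $$M=\sum P\bigl(A_{ij}(\ell)\cap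 A_{uv}(t)\bigr)$$ be the part of the second sum with $i,j,u,v$ pairwise distinct and $\ell\ne t$. If $n\ge\binom{k+1}{2}$ and $k\to\infty$, then $M\sim\dfrac{k^5}{16\pi n}$. If $n\ge\binom{k+1}{2}$ and $n/k^5\to0$, then $D\sim M$. -/

import Mathlib

open Filter Topology Asymptotics

noncomputable section

namespace EqualParts

open Classical in
/-- Probability of the event `p` for a uniformly random element of the finite set `s`. -/
def prob {α : Type} (s : Finset α) (p : α → Prop) : ℝ :=
  ((s.filter p).card : ℝ) / (s.card : ℝ)

/-- Expectation of `X` at a uniformly random element of the finite set `s`. -/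
def expect {α : Type} (s : Finset α) (X : α → ℕ) : ℝ :=
  (∑ x ∈ s, (X x : ℝ)) / (s.card : ℝ)

open Classical in
/-- The surjections `[n] → [k]`. -/
def surjections (n k : ℕ) : Finset (Fin n → Fin k) :=
  Finset.univ.filter Function.Surjective

/-- The size of the fibre of `f` over `i`. -/
def fibreSize {n k : ℕ} (f : Fin n → Fin k) (i : Fin k) : ℕ :=
  (Finset.univ.filter (fun x => f x = i)).card

/-- Some two fibres of `f` have the same size. -/
def HasEqualFibres {n k : ℕ} (f : Fin n → Fin k) : Prop :=
  ∃ i j : Fin k, i < j ∧ fibreSize f i = fibreSize f j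

/-- The number of pairs `i < j` whose fibres have the same size. -/
def equalFibrePairs {n k : ℕ} (f : Fin n → Fin k) : ℕ :=
  (Finset.univ.filter
    (fun p : Fin k × Fin k => p.1 < p.2 ∧ fibreSize f p.1 = fibreSize f p.2)).card

/-- The partitions of the set `[n]` into `k` (non-empty) blocks. -/
def setPartitions (n k : ℕ) : Finset (Finpartition (Finset.univ : Finset (Fin n))) :=
  Finset.univ.filter (fun P => P.parts.card = k)

/-- Some two different blocks of `P` have the same size. -/
def HasEqualBlocks {n : ℕ} (P : Finpartition (Finset.univ : Finset (Fin n))) : Prop :=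
  ∃ B ∈ P.parts, ∃ C ∈ P.parts, B ≠ C ∧ B.card = C.card

/-- The number of unordered pairs of different blocks of `P` of the same size. -/
def equalBlockPairs {n : ℕ} (P : Finpartition (Finset.univ : Finset (Fin n))) : ℕ :=
  ((P.parts.powersetCard 2).filter
    (fun q => ∀ B ∈ q, ∀ C ∈ q, B.card = C.card)).card

/-- The indices `((i, j), t)`, with `i < j` and `1 ≤ t ≤ n`, of the events `coincide`. -/
def indices (n k : ℕ) : Finset ((Fin k × Fin k) × ℕ) :=
  (Finset.univ.filter (fun p : Fin k × Fin k => p.1 < p.2)) ×ˢ Finset.Icc 1 n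

/-- For `a = ((i, j), t)`, the event that the fibres over `i` and over `j` both have size `t`. -/
def coincide {n k : ℕ} (a : (Fin k × Fin k) × ℕ) (f : Fin n → Fin k) : Prop :=
  fibreSize f a.1.1 = a.2 ∧ fibreSize f a.1.2 = a.2

/-- The denominator `∑ P(A_a) + 2 ∑_{a < b} P(A_a ∩ A_b)` of the Chung–Erdős inequality for the
events `coincide a` and a random surjection; the second sum runs over unordered pairs of indices,
so its double is the sum over ordered pairs of different indices. -/
def secondMomentDenominator (n k : ℕ) : ℝ :=
  ∑ a ∈ indices n k, prob (surjections n k) (coincide a) +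
    ∑ c ∈ (indices n k).offDiag,
      prob (surjections n k) (fun f => coincide c.1 f ∧ coincide c.2 f)

/-- The part of `secondMomentDenominator` that comes from the index pairs
`((i, j), l)`, `((u, v), t)` with `i, j, u, v` distinct and `l ≠ t`. -/
def secondMomentMainTerm (n k : ℕ) : ℝ :=
  ∑ c ∈ (indices n k).offDiag.filter (fun c =>
      c.1.1.1 ≠ c.2.1.1 ∧ c.1.1.1 ≠ c.2.1.2 ∧ c.1.1.2 ≠ c.2.1.1 ∧ c.1.1.2 ≠ c.2.1.2 ∧
        c.1.2 ≠ c.2.2),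
    prob (surjections n k) (fun f => coincide c.1 f ∧ coincide c.2 f)

end EqualParts

end

/-! Let X be the number of pairs i < j with fibres of equal size. For a uniformly random function,
the event that prescribed fibre sizes agree says that a sum of n independent steps vanishes, so its
probability is an integral over a torus of the n-th power of a characteristic function
(`prob_univ_eq_integral`). For d disjoint pairs this function is 1 - (2/k) ∑ (1 - cos θ_r), and
rescaling by √(n/k) gives the probability (2√π)^(-d) (k/n)^(d/2) asymptotically
(`tendsto_scaled_integral`). For d + 1 fibres of one common size the bound O((k/n)^(d/2)) is enough
(`prob_star_le`). Passing to surjections costs at most k exp(-n/k) (`abs_prob_surjections_sub_le`),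
which is negligible once n ≥ C(k+1,2). Counting pairs and pairs of disjoint pairs then gives E X and
M. On surjections the denominator D is E X². Its part outside M consists of E X, of coincidences
among three fibres (about k³ · k/n) and of coincidences among four (about k⁴ (k/n)^(3/2)); all are
small against k⁵/n when n/k⁵ → 0. Since then (E X)² ~ M ~ D, Cauchy–Schwarz gives P(X > 0) → 1. If n
< C(k+1,2), an equality is forced. If n/k⁵ → ∞, a union bound over pairs gives P(X > 0) → 0.
Partitions reduce to surjections because taking the kernel is k!-to-one and keeps the number of
coincidences (`expect_setPartitions`). -/

noncomputable section

namespace EqualParts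

open MeasureTheory Real

/-! ### Fourier formulas and bounds for coincidences of fibre sizes. -/

/-- The cube `(-π, π]^d`. -/
def torusBox (d : ℕ) : Set (Fin d → ℝ) := Set.univ.pi fun _ => Set.Ioc (-π) π

lemma integral_cexp_int (m : ℤ) :
    ∫ θ in Set.Ioc (-π) π, Complex.exp (m * θ * Complex.I) = if m = 0 then (2 * π : ℂ) else 0 := by
  rw [← intervalIntegral.integral_of_le (by linarith [pi_pos])]
  split_ifs with h
  · simp [h]; ring
  · have hc : (m : ℂ) * Complex.I ≠ 0 := by simp [h]
    have h1 : ∀ θ : ℝ, Complex.exp (m * θ * Complex.I) = Complex.exp (m * Complex.I * θ) := by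
      intro θ; ring_nf
    simp_rw [h1]
    rw [integral_exp_mul_complex hc, div_eq_zero_iff]
    left
    rw [sub_eq_zero, Complex.exp_eq_exp_iff_exists_int]
    exact ⟨m, by push_cast; ring⟩

lemma volume_restrict_torusBox (d : ℕ) :
    (volume : Measure (Fin d → ℝ)).restrict (torusBox d)
      = Measure.pi fun _ => volume.restrict (Set.Ioc (-π) π) := by
  rw [volume_pi, torusBox, Measure.restrict_pi_pi]

lemma measurableSet_torusBox (d : ℕ) : MeasurableSet (torusBox d) :=
  MeasurableSet.univ_pi fun _ => measurableSet_Ioc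

/-- The number of words whose increments `v` sum to zero, as a Fourier integral. -/
lemma card_zero_sum_mul {κ : Type} [Fintype κ] {d : ℕ} (v : κ → Fin d → ℤ) (n : ℕ) :
    ((Finset.univ.filter fun f : Fin n → κ => ∀ r, ∑ x, v (f x) r = 0).card : ℂ) * (2 * π) ^ d
      = ∫ θ in torusBox d, (∑ c, Complex.exp (∑ r, v c r * θ r * Complex.I)) ^ n := by
  -- The power expands over words f; orthogonality of characters then keeps the words with zero sum.
  have h1 : ∀ θ : Fin d → ℝ, (∑ c, Complex.exp (∑ r, v c r * θ r * Complex.I)) ^ n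
      = ∑ f : Fin n → κ, ∏ r, Complex.exp (((∑ x, v (f x) r : ℤ) : ℂ) * θ r * Complex.I) := by
    intro θ
    rw [Fintype.sum_pow]
    refine Finset.sum_congr rfl fun f _ => ?_
    rw [← Complex.exp_sum, ← Complex.exp_sum, Finset.sum_comm]
    simp [Finset.sum_mul]
  simp_rw [h1]
  rw [volume_restrict_torusBox, integral_finsetSum]
  · have h2 : ∀ f : Fin n → κ,
        ∏ r, ∫ t in Set.Ioc (-π) π, Complex.exp (((∑ x, v (f x) r : ℤ) : ℂ) * t * Complex.I)
          = if ∀ r, ∑ x, v (f x) r = 0 then (2 * π : ℂ) ^ d else 0 := by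
      intro f
      simp_rw [integral_cexp_int]
      split_ifs with h
      · simp [h]
      · push Not at h
        obtain ⟨r, hr⟩ := h
        exact Finset.prod_eq_zero (Finset.mem_univ r) (if_neg hr)
    have h3 : ∀ f : Fin n → κ, ∫ θ : Fin d → ℝ,
        ∏ r, Complex.exp (((∑ x, v (f x) r : ℤ) : ℂ) * θ r * Complex.I)
          ∂(Measure.pi fun _ => volume.restrict (Set.Ioc (-π) π))
          = if ∀ r, ∑ x, v (f x) r = 0 then (2 * π : ℂ) ^ d else 0 := by
      intro f
      rw [← h2 f]
      exact integral_fintype_prod_eq_prod (𝕜 := ℂ) (fun (r : Fin d) (t : ℝ) =>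
        Complex.exp (((∑ x, v (f x) r : ℤ) : ℂ) * t * Complex.I))
    rw [Finset.sum_congr rfl fun f _ => h3 f, ← Finset.sum_filter, Finset.sum_const, nsmul_eq_mul]
  · intro f _
    refine Integrable.fintype_prod (f := fun (r : Fin d) (t : ℝ) =>
      Complex.exp (((∑ x, v (f x) r : ℤ) : ℂ) * t * Complex.I)) fun r => ?_
    exact (Continuous.integrableOn_Ioc (by fun_prop))

lemma fibreSize_eq_iff {n k : ℕ} (f : Fin n → Fin k) (i j : Fin k) :
    fibreSize f i = fibreSize f j ↔
      ∑ x, ((if f x = i then 1 else 0) - (if f x = j then 1 else 0) : ℤ) = 0 := by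
  rw [Finset.sum_sub_distrib, sub_eq_zero, Finset.sum_boole, Finset.sum_boole, fibreSize, fibreSize]
  norm_cast

lemma prob_univ_eq_integral {n k d : ℕ} (hk : 1 ≤ k) (a b : Fin d → Fin k) :
    (prob Finset.univ (fun f : Fin n → Fin k => ∀ r, fibreSize f (a r) = fibreSize f (b r)) : ℂ)
      = (2 * π : ℂ)⁻¹ ^ d * ∫ θ in torusBox d, ((∑ c : Fin k, Complex.exp (∑ r,
          ((if c = a r then 1 else 0) - (if c = b r then 1 else 0) : ℤ) * θ r * Complex.I)) / k) ^ n
    := by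
  simp_rw [div_pow]
  rw [integral_div, ← card_zero_sum_mul (fun (c : Fin k) (r : Fin d) =>
    ((if c = a r then 1 else 0) - (if c = b r then 1 else 0) : ℤ)) n]
  have hπ : (π : ℂ) ≠ 0 := by exact_mod_cast pi_ne_zero
  have hk' : (k : ℂ) ≠ 0 := by exact_mod_cast (by omega : k ≠ 0)
  unfold prob
  simp_rw [fibreSize_eq_iff]
  rw [Finset.card_univ, Fintype.card_fun, Fintype.card_fin, Fintype.card_fin]
  push_cast
  field_simp
  rw [mul_assoc, ← mul_pow, one_div_mul_cancel (by simp [hπ]), one_pow, mul_one]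

/-- A quadratic lower bound valid on the whole box: it is what dominates the Fourier integrands by
Gaussians. -/
lemma one_sub_cos_ge {x : ℝ} (hx : x ∈ Set.Ioc (-π) π) : 2 / π ^ 2 * x ^ 2 ≤ 1 - cos x := by
  linarith [cos_le_one_sub_mul_cos_sq (abs_le.2 ⟨hx.1.le, hx.2⟩)]


/-- The characteristic function of `d` disjoint pair differences. -/
lemma sum_cexp_pairs {k d : ℕ} (a b : Fin d → Fin k) (hab : (Sum.elim a b).Injective)
    (θ : Fin d → ℝ) :
    ∑ c : Fin k, Complex.exp (∑ r,
        ((if c = a r then 1 else 0) - (if c = b r then 1 else 0) : ℤ) * θ r * Complex.I)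
      = ((k - 2 * ∑ r, (1 - cos (θ r)) : ℝ) : ℂ) := by
  set F : Fin k → ℂ := fun c => Complex.exp (∑ r,
        ((if c = a r then 1 else 0) - (if c = b r then 1 else 0) : ℤ) * θ r * Complex.I) with hF
  -- `F` is 1 off the 2d entries of the pairs, so `F - 1` only sees these; they are distinct by
  -- `hab`.
  have hsum : ∑ c, (F c - 1) = ∑ s : Fin d ⊕ Fin d, (F (Sum.elim a b s) - 1) := by
    rw [← Finset.sum_image (f := fun c => F c - 1) (g := Sum.elim a b) (s := Finset.univ)
      (fun x _ y _ h => hab h)]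
    symm
    apply Finset.sum_subset (Finset.subset_univ _)
    intro c _ hc
    have h1 : ∀ r, c ≠ a r := fun r h => hc (Finset.mem_image.2 ⟨Sum.inl r, by simp, by simp [h]⟩)
    have h2 : ∀ r, c ≠ b r := fun r h => hc (Finset.mem_image.2 ⟨Sum.inr r, by simp, by simp [h]⟩)
    simp [hF, h1, h2]
  have hne : ∀ r s, a r ≠ b s := fun r s h => by
    have := @hab (Sum.inl r) (Sum.inr s) (by simpa using h)
    simp at this
  have hia : ∀ r s, a r = a s ↔ r = s := fun r s =>
    ⟨fun h => Sum.inl_injective (@hab (Sum.inl r) (Sum.inl s) (by simpa using h)), fun h => by rw [h]⟩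
  have hib : ∀ r s, b r = b s ↔ r = s := fun r s =>
    ⟨fun h => Sum.inr_injective (@hab (Sum.inr r) (Sum.inr s) (by simpa using h)), fun h => by rw [h]⟩
  have ha : ∀ r, F (a r) = Complex.exp (θ r * Complex.I) := by
    intro r
    simp [hF, hne, hia]
  have hb : ∀ r, F (b r) = Complex.exp (-(θ r * Complex.I)) := by
    intro r
    simp [hF, fun r s => (hne r s).symm, hib]
  rw [Finset.sum_sub_distrib, Fintype.sum_sum_type] at hsum
  simp only [Sum.elim_inl, Sum.elim_inr, ha, hb, Finset.sum_const, Finset.card_univ,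
    Fintype.card_fin, nsmul_eq_mul, mul_one] at hsum
  rw [← Finset.sum_add_distrib] at hsum
  rw [sub_eq_iff_eq_add.1 hsum]
  push_cast
  rw [Finset.mul_sum, add_comm, sub_eq_add_neg, ← Finset.sum_neg_distrib]
  congr 1
  refine Finset.sum_congr rfl fun r _ => ?_
  rw [Complex.cos]
  ring_nf

lemma prob_pairs_eq_integral {n k d : ℕ} (hk : 1 ≤ k) (a b : Fin d → Fin k)
    (hab : (Sum.elim a b).Injective) :
    prob Finset.univ (fun f : Fin n → Fin k => ∀ r, fibreSize f (a r) = fibreSize f (b r))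
      = (2 * π)⁻¹ ^ d * ∫ θ in torusBox d, (1 - 2 / k * ∑ r, (1 - cos (θ r))) ^ n := by
  have h := prob_univ_eq_integral (n := n) hk a b
  have hk' : (k : ℝ) ≠ 0 := by exact_mod_cast (by omega : k ≠ 0)
  have h2 : ∀ θ : Fin d → ℝ, ((∑ c : Fin k, Complex.exp (∑ r,
      ((if c = a r then 1 else 0) - (if c = b r then 1 else 0) : ℤ) * θ r * Complex.I)) / k) ^ n
      = (((1 - 2 / k * ∑ r, (1 - cos (θ r))) ^ n : ℝ) : ℂ) := by
    intro θ
    rw [sum_cexp_pairs a b hab, ← Complex.ofReal_natCast, ← Complex.ofReal_div,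
      ← Complex.ofReal_pow]
    congr 2
    field_simp
  simp_rw [h2] at h
  rw [integral_complex_ofReal] at h
  exact_mod_cast h

/-- The characteristic function of the differences to a fixed fibre, in absolute value. -/
lemma norm_sum_cexp_star_le {k d : ℕ} (hk : d + 2 ≤ k) (a : Fin (d + 1) → Fin k)
    (ha : a.Injective) (θ : Fin d → ℝ) :
    ‖(∑ c : Fin k, Complex.exp (∑ r : Fin d, ((if c = a r.succ then 1 else 0)
        - (if c = a 0 then 1 else 0) : ℤ) * θ r * Complex.I)) / k‖
      ≤ exp (-(1 / (k * (d + 2))) * ∑ r, (1 - cos (θ r))) := by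
  set F : Fin k → ℂ := fun c => Complex.exp (∑ r : Fin d,
        ((if c = a r.succ then 1 else 0) - (if c = a 0 then 1 else 0) : ℤ) * θ r * Complex.I)
    with hF
  have hsum : ∑ c, (F c - 1) = ∑ s : Fin (d + 1), (F (a s) - 1) := by
    rw [← Finset.sum_image (f := fun c => F c - 1) (g := a) (s := Finset.univ)
      (fun x _ y _ h => ha h)]
    symm
    apply Finset.sum_subset (Finset.subset_univ _)
    intro c _ hc
    have h1 : ∀ r, c ≠ a r := fun r h => hc (Finset.mem_image.2 ⟨r, by simp, by simp [h]⟩)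
    simp [hF, h1]
  have hnorm : ∀ c, ‖F c‖ = 1 := by
    intro c
    simp only [hF]
    rw [← Finset.sum_mul]
    have : (∑ r : Fin d, (((if c = a r.succ then 1 else 0) - (if c = a 0 then 1 else 0) : ℤ) : ℂ)
        * θ r) = ((∑ r : Fin d, (((if c = a r.succ then 1 else 0) - (if c = a 0 then 1 else 0) : ℤ)
          : ℝ) * θ r : ℝ) : ℂ) := by
      simp only [Complex.ofReal_sum, Complex.ofReal_mul, Complex.ofReal_intCast]
    rw [this, Complex.norm_exp_ofReal_mul_I]
  have hs : ∀ r : Fin d, (F (a r.succ)).re = cos (θ r) := by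
    intro r
    have h : F (a r.succ) = Complex.exp (θ r * Complex.I) := by
      simp [hF, ha.eq_iff]
    rw [h, Complex.exp_ofReal_mul_I_re]
  set B : ℂ := ∑ s, F (a s) with hB
  -- The fibres outside the star contribute 1 each. At least one of them is needed: for d = 1 and k
  -- = 2 the average is cos θ, of modulus 1 at π, and no decay could hold there.
  set A : ℝ := k - (d + 1) with hA
  set S : ℝ := ∑ r, (1 - cos (θ r)) with hS
  have hkd : (d : ℝ) + 2 ≤ k := by exact_mod_cast hk
  have hd0 : (0 : ℝ) ≤ d := Nat.cast_nonneg d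
  have hAB : ∑ c, F c = A + B := by
    rw [Finset.sum_sub_distrib, Finset.sum_sub_distrib] at hsum
    simp only [Finset.sum_const, Finset.card_univ, Fintype.card_fin, nsmul_eq_mul, mul_one] at hsum
    rw [sub_eq_iff_eq_add.1 hsum, hA]
    push_cast; ring
  have hBn : ‖B‖ ≤ d + 1 := by
    refine (norm_sum_le _ _).trans ?_
    simp [hnorm]
  have hBre : B.re ≤ (d + 1) - S := by
    rw [hB, Complex.re_sum, Fin.sum_univ_succ]
    simp only [hs, hS, Finset.sum_sub_distrib, Finset.sum_const, Finset.card_univ, Fintype.card_fin,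
      nsmul_eq_mul, mul_one]
    have := (Complex.re_le_norm (F (a 0))).trans_eq (hnorm _)
    linarith
  have hS0 : 0 ≤ S := Finset.sum_nonneg fun r _ => by linarith [cos_le_one (θ r)]
  have hA1 : 1 ≤ A := by rw [hA]; linarith
  -- From k = A + (d + 1) and A ≥ 1; this is the origin of the factor d + 2 in the exponent.
  have hAk : k ≤ A * (d + 2) := by rw [hA]; nlinarith
  have hk0 : (0 : ℝ) < k := by linarith
  have hsq : ‖(A : ℂ) + B‖ ^ 2 ≤ k ^ 2 - 2 * A * S := by
    have h1 : ‖(A : ℂ) + B‖ ^ 2 = A ^ 2 + 2 * A * B.re + ‖B‖ ^ 2 := by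
      rw [← Complex.normSq_eq_norm_sq, ← Complex.normSq_eq_norm_sq, Complex.normSq_apply,
        Complex.normSq_apply]
      simp
      ring
    have h2 : ‖B‖ ^ 2 ≤ ((d : ℝ) + 1) ^ 2 := by gcongr
    have h3 : A * B.re ≤ A * ((d + 1) - S) := by gcongr
    have h4 : (k : ℝ) = A + (d + 1) := by rw [hA]; ring
    rw [h1, h4]
    nlinarith
  have hfin : (‖(A : ℂ) + B‖ / k) ^ 2 ≤ exp (-(1 / (k * (d + 2))) * S) ^ 2 := by
    rw [div_pow, ← exp_nat_mul, div_le_iff₀ (by positivity)]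
    refine hsq.trans ?_
    have h5 := add_one_le_exp (((2 : ℕ) : ℝ) * (-(1 / (k * (d + 2))) * S))
    have h6 : S * k ≤ S * (A * (d + 2)) := by gcongr
    calc (k : ℝ) ^ 2 - 2 * A * S ≤ (((2 : ℕ) : ℝ) * (-(1 / (k * (d + 2))) * S) + 1) * k ^ 2 := by
          have h7 : (((2 : ℕ) : ℝ) * (-(1 / (k * (d + 2))) * S) + 1) * k ^ 2
            = k ^ 2 - 2 * (S * k / (d + 2)) := by
            field_simp; push_cast; ring
          rw [h7]
          have : S * k / (d + 2) ≤ S * A := by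
            rw [div_le_iff₀ (by linarith)]; linarith
          linarith
      _ ≤ _ := by gcongr
  rw [hAB, norm_div, Complex.norm_natCast]
  exact le_of_sq_le_sq hfin (exp_pos _).le

/-- `d + 1` prescribed fibres are of the same size with probability `O((k / n) ^ (d / 2))`. -/
lemma prob_star_le {n k d : ℕ} (hn : 1 ≤ n) (hk : d + 2 ≤ k) (a : Fin (d + 1) → Fin k)
    (ha : a.Injective) :
    prob Finset.univ (fun f : Fin n → Fin k => ∀ r : Fin d, fibreSize f (a r.succ)
      = fibreSize f (a 0)) ≤ (√(π * (d + 2) * (k / n))) ^ d := by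
  have h := prob_univ_eq_integral (n := n) (by omega) (fun r : Fin d => a r.succ) (fun _ => a 0)
  have hn0 : (0 : ℝ) < n := by exact_mod_cast hn
  have hk0 : (0 : ℝ) < k := by exact_mod_cast (by omega : 0 < k)
  have hpi := pi_pos
  set β : ℝ := n / (k * (d + 2)) * (2 / π ^ 2) with hβ
  have hβ0 : 0 < β := by positivity
  have hnn : 0 ≤ prob Finset.univ (fun f : Fin n → Fin k => ∀ r : Fin d, fibreSize f (a r.succ)
      = fibreSize f (a 0)) := by unfold prob; positivity
  have h1 := congrArg (‖·‖) h
  simp only [norm_mul, Complex.norm_real, Real.norm_of_nonneg hnn] at h1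
  rw [h1]
  have hgi : Integrable (fun θ : Fin d → ℝ => ∏ r, exp (-β * θ r ^ 2)) :=
    Integrable.fintype_prod (f := fun (_ : Fin d) (t : ℝ) => exp (-β * t ^ 2))
      fun r => integrable_exp_neg_mul_sq hβ0
  have h2 : ‖∫ θ in torusBox d, ((∑ c : Fin k, Complex.exp (∑ r : Fin d,
      ((if c = a r.succ then 1 else 0) - (if c = a 0 then 1 else 0) : ℤ) * θ r * Complex.I)) / k) ^ n‖
      ≤ √(π / β) ^ d := by
    calc _ ≤ ∫ θ in torusBox d, ∏ r, exp (-β * θ r ^ 2) := by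
          apply norm_integral_le_of_norm_le hgi.integrableOn
          rw [ae_restrict_iff' (measurableSet_torusBox d)]
          refine ae_of_all _ fun θ hθ => ?_
          rw [norm_pow]
          refine (pow_le_pow_left₀ (norm_nonneg _) (norm_sum_cexp_star_le hk a ha θ) n).trans ?_
          rw [← exp_nat_mul, ← exp_sum, Finset.mul_sum, Finset.mul_sum]
          refine exp_le_exp.2 (Finset.sum_le_sum fun r _ => ?_)
          have := one_sub_cos_ge (hθ r (Set.mem_univ r))
          calc (n : ℝ) * (-(1 / (k * (d + 2))) * (1 - cos (θ r)))
              = -((n / (k * (d + 2))) * (1 - cos (θ r))) := by ring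
            _ ≤ -((n / (k * (d + 2))) * (2 / π ^ 2 * θ r ^ 2)) := by gcongr
            _ = -β * θ r ^ 2 := by rw [hβ]; ring
      _ ≤ ∫ θ : Fin d → ℝ, ∏ r, exp (-β * θ r ^ 2) :=
          setIntegral_le_integral hgi (ae_of_all _ fun θ => by positivity)
      _ = √(π / β) ^ d := by
          rw [integral_fintype_prod_volume_eq_pow (fun t : ℝ => exp (-β * t ^ 2)),
            integral_gaussian, Fintype.card_fin]
  calc _ ≤ ‖(2 * π : ℂ)⁻¹ ^ d‖ * √(π / β) ^ d := by gcongr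
    _ = (√(π / β) / (2 * π)) ^ d := by
        rw [norm_pow, norm_inv, norm_mul, Complex.norm_real, Real.norm_of_nonneg hpi.le, ← mul_pow]
        simp; ring
    -- The quantity under the root on the left is π (d + 2) k / (8 n); the factor 1/8 is given away.
    _ ≤ _ := by
        gcongr
        rw [div_le_iff₀ (by positivity)]
        apply sqrt_le_iff.2 ⟨by positivity, ?_⟩
        rw [mul_pow, sq_sqrt (by positivity), hβ]
        field_simp
        nlinarith [pi_gt_three]

end EqualParts

/-! ### The local limit theorem by dominated convergence. -/

namespace EqualParts

open MeasureTheory Real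

/-- Squeezed by exp(-x/(1-x)) ≤ 1 - x ≤ exp(-x), valid for every x < 1, so no sign of x is needed.
The left inequality is 1 + y ≤ exp y at y = x/(1-x). -/
lemma tendsto_one_sub_pow_exp {x : ℕ → ℝ} {n : ℕ → ℕ} {s : ℝ} (hx : Tendsto x atTop (𝓝 0))
    (hnx : Tendsto (fun m => n m * x m) atTop (𝓝 s)) :
    Tendsto (fun m => (1 - x m) ^ n m) atTop (𝓝 (exp (-s))) := by
  have hlow : Tendsto (fun m => exp (-(n m * x m / (1 - x m)))) atTop (𝓝 (exp (-s))) := by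
    have h1 : Tendsto (fun m => n m * x m / (1 - x m)) atTop (𝓝 (s / (1 - 0))) :=
      hnx.div (hx.const_sub 1) (by norm_num)
    rw [sub_zero, div_one] at h1
    exact (continuous_exp.tendsto _).comp h1.neg
  have hup : Tendsto (fun m => exp (-(n m * x m))) atTop (𝓝 (exp (-s))) :=
    (continuous_exp.tendsto _).comp hnx.neg
  have hlt : ∀ᶠ m in atTop, x m < 1 := hx.eventually_lt_const one_pos
  refine tendsto_of_tendsto_of_tendsto_of_le_of_le' hlow hup ?_ ?_
  · filter_upwards [hlt] with m hm
    have h0 : 0 < 1 - x m := by linarith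
    have h1 : exp (-(x m / (1 - x m))) ≤ 1 - x m := by
      rw [exp_neg, inv_le_comm₀ (exp_pos _) h0]
      refine le_trans (le_of_eq ?_) (add_one_le_exp _)
      field_simp
      ring
    calc exp (-(n m * x m / (1 - x m))) = exp (-(x m / (1 - x m))) ^ n m := by
          rw [← exp_nat_mul]; ring_nf
      _ ≤ _ := by gcongr
  · filter_upwards [hlt] with m hm
    have h1 : 1 - x m ≤ exp (-x m) := one_sub_le_exp_neg _
    calc (1 - x m) ^ n m ≤ exp (-x m) ^ n m := pow_le_pow_left₀ (by linarith) h1 _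
      _ = _ := by rw [← exp_nat_mul]; ring_nf

/-- Pointwise limit of the rescaled exponent, with l = n/k. The error 5/48 is twice the constant
5/96 of `cos_bound`, which applies once l ≥ y². -/
lemma tendsto_mul_one_sub_cos {l : ℕ → ℝ} (hl : Tendsto l atTop atTop) (y : ℝ) :
    Tendsto (fun m => 2 * l m * (1 - cos ((√(l m))⁻¹ * y))) atTop (𝓝 (y ^ 2)) := by
  have hlow : Tendsto (fun m => y ^ 2 - 5 / 48 * y ^ 4 * (l m)⁻¹) atTop (𝓝 (y ^ 2)) := by
    simpa using (hl.inv_tendsto_atTop.const_mul (5 / 48 * y ^ 4)).const_sub (y ^ 2)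
  refine tendsto_of_tendsto_of_tendsto_of_le_of_le' hlow tendsto_const_nhds ?_ ?_
  · filter_upwards [hl.eventually_gt_atTop 0, hl.eventually_ge_atTop (y ^ 2)] with m h0 hy
    have hsq : (√(l m))⁻¹ ^ 2 = (l m)⁻¹ := by rw [inv_pow, sq_sqrt h0.le]
    have habs : |(√(l m))⁻¹ * y| ≤ 1 := by
      rw [← sq_le_one_iff_abs_le_one, mul_pow, hsq]
      rw [inv_mul_le_one₀ h0]; exact hy
    have hb := (abs_le.1 (cos_bound habs)).2
    rw [← abs_pow, abs_of_nonneg (by positivity)] at hb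
    have h4 : ((√(l m))⁻¹ * y) ^ 4 = (l m)⁻¹ ^ 2 * y ^ 4 := by
      rw [mul_pow, show 4 = 2 * 2 by rfl, pow_mul, hsq, pow_mul]
    have h2 : ((√(l m))⁻¹ * y) ^ 2 = (l m)⁻¹ * y ^ 2 := by rw [mul_pow, hsq]
    rw [h4, h2] at hb
    have h5 : 2 * l m * ((l m)⁻¹ * y ^ 2 / 2 - (l m)⁻¹ ^ 2 * y ^ 4 * (5 / 96))
        ≤ 2 * l m * (1 - cos ((√(l m))⁻¹ * y)) :=
      mul_le_mul_of_nonneg_left (by linarith) (by positivity)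
    refine le_trans (le_of_eq ?_) h5
    field_simp
    ring
  · filter_upwards [hl.eventually_gt_atTop 0] with m h0
    have hsq : (√(l m))⁻¹ ^ 2 = (l m)⁻¹ := by rw [inv_pow, sq_sqrt h0.le]
    have hb := one_sub_sq_div_two_le_cos (x := (√(l m))⁻¹ * y)
    rw [mul_pow, hsq] at hb
    calc 2 * l m * (1 - cos ((√(l m))⁻¹ * y)) ≤ 2 * l m * ((l m)⁻¹ * y ^ 2 / 2) := by
          gcongr; linarith
      _ = y ^ 2 := by field_simp

/-- The local limit theorem for `d` disjoint pair differences, in Fourier form. -/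
lemma tendsto_scaled_integral (d : ℕ) {n k : ℕ → ℕ} (hk : Tendsto k atTop atTop)
    (hl : Tendsto (fun m => (n m : ℝ) / k m) atTop atTop) :
    Tendsto (fun m => √((n m : ℝ) / k m) ^ d * ((2 * π)⁻¹ ^ d *
      ∫ θ in torusBox d, (1 - 2 / k m * ∑ r, (1 - cos (θ r))) ^ n m)) atTop
      (𝓝 ((2 * √π)⁻¹ ^ d)) := by
  have hpi := pi_pos
  set l : ℕ → ℝ := fun m => (n m : ℝ) / k m with hldef
  -- Extending by zero off the box lets the substitution θ = y/√l take place on a fixed domain.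
  set G : ℕ → (Fin d → ℝ) → ℝ := fun m => (torusBox d).indicator
    fun θ => (1 - 2 / k m * ∑ r, (1 - cos (θ r))) ^ n m with hG
  have hlim : Tendsto (fun m => ∫ y : Fin d → ℝ, G m ((√(l m))⁻¹ • y)) atTop
      (𝓝 (∫ y : Fin d → ℝ, ∏ r, exp (-1 * y r ^ 2))) := by
    refine tendsto_integral_filter_of_dominated_convergence
      (fun y => ∏ r, exp (-(4 / π ^ 2) * y r ^ 2)) ?_ ?_ ?_ ?_
    · refine Eventually.of_forall fun m => Measurable.aestronglyMeasurable ?_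
      refine Measurable.comp (g := G m) ?_ (by fun_prop)
      refine Measurable.indicator ?_ (measurableSet_torusBox d)
      exact Continuous.measurable (by fun_prop)
    -- Since the sum of the 1 - cos is at most 2d, k ≥ 4d makes the base nonnegative, so that 1 - x
    -- ≤ exp(-x) may be raised to the n-th power.
    · filter_upwards [hl.eventually_gt_atTop 0, hk.eventually_ge_atTop (4 * d + 1)] with m h0 hkm
      refine ae_of_all _ fun y => ?_
      simp only [hG]
      by_cases hy : (√(l m))⁻¹ • y ∈ torusBox d
      swap
      · rw [Set.indicator_of_notMem hy, norm_zero]; positivity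
      rw [Set.indicator_of_mem hy]
      have hk0 : (0 : ℝ) < k m := by exact_mod_cast (by omega : 0 < k m)
      have hkd : (4 : ℝ) * d ≤ k m := by exact_mod_cast (by omega : 4 * d ≤ k m)
      set S : ℝ := ∑ r, (1 - cos (((√(l m))⁻¹ • y) r)) with hS
      have hS2 : S ≤ 2 * d := by
        have : S ≤ ∑ r : Fin d, (2 : ℝ) := by
          refine Finset.sum_le_sum fun r _ => ?_
          linarith [neg_one_le_cos (((√(l m))⁻¹ • y) r)]
        simpa [mul_comm] using this
      have hSl : (4 / π ^ 2) * ∑ r, y r ^ 2 ≤ 2 * l m * S := by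
        rw [hS, Finset.mul_sum, Finset.mul_sum]
        refine Finset.sum_le_sum fun r _ => ?_
        have h1 := one_sub_cos_ge (hy r (Set.mem_univ r))
        have hsq : (√(l m))⁻¹ ^ 2 = (l m)⁻¹ := by rw [inv_pow, sq_sqrt h0.le]
        calc 4 / π ^ 2 * y r ^ 2 = 2 * l m * (2 / π ^ 2 * ((√(l m))⁻¹ • y) r ^ 2) := by
              rw [Pi.smul_apply, smul_eq_mul, mul_pow, hsq]; field_simp; ring
          _ ≤ _ := by gcongr
      have hx1 : 2 / k m * S ≤ 1 := by
        rw [div_mul_eq_mul_div, div_le_one hk0]; linarith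
      rw [Real.norm_of_nonneg (by positivity), ← exp_sum]
      calc (1 - 2 / k m * S) ^ n m ≤ exp (-(2 / k m * S)) ^ n m :=
            pow_le_pow_left₀ (by linarith) (one_sub_le_exp_neg _) _
        _ = exp (-(2 * l m * S)) := by rw [← exp_nat_mul, hldef]; ring_nf
        _ ≤ _ := by
            gcongr
            rw [← Finset.mul_sum]
            linarith
    · exact Integrable.fintype_prod (f := fun (_ : Fin d) (t : ℝ) => exp (-(4 / π ^ 2) * t ^ 2))
        fun r => integrable_exp_neg_mul_sq (by positivity)
    · refine ae_of_all _ fun y => ?_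
      have hR : Tendsto (fun m => (√(l m))⁻¹) atTop (𝓝 0) :=
        (tendsto_sqrt_atTop.comp hl).inv_tendsto_atTop
      have hbox : ∀ᶠ m in atTop, (√(l m))⁻¹ • y ∈ torusBox d := by
        have h1 : ∀ r, ∀ᶠ m in atTop, (√(l m))⁻¹ * y r ∈ Set.Ioc (-π) π := by
          intro r
          have h2 : Tendsto (fun m => (√(l m))⁻¹ * y r) atTop (𝓝 0) := by
            simpa using hR.mul_const (y r)
          exact h2.eventually_mem (Ioc_mem_nhds (by linarith) hpi)
        filter_upwards [eventually_all.2 h1] with m hm r _ using hm r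
      have hnx : Tendsto (fun m => (n m : ℝ) * (2 / k m * ∑ r, (1 - cos (((√(l m))⁻¹ • y) r))))
          atTop (𝓝 (∑ r, y r ^ 2)) := by
        have h1 := tendsto_finsetSum (Finset.univ : Finset (Fin d))
          fun r _ => tendsto_mul_one_sub_cos hl (y r)
        refine h1.congr fun m => ?_
        rw [← Finset.mul_sum, hldef]
        simp only [Pi.smul_apply, smul_eq_mul]
        ring
      have hx : Tendsto (fun m => 2 / k m * ∑ r, (1 - cos (((√(l m))⁻¹ • y) r)))
          atTop (𝓝 0) := by
        have hk' : Tendsto (fun m => (2 : ℝ) / k m) atTop (𝓝 0) :=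
          (tendsto_natCast_atTop_atTop.comp hk).const_div_atTop 2
        have h1 : Tendsto (fun m => ∑ r, (1 - cos (((√(l m))⁻¹ • y) r))) atTop (𝓝 0) := by
          have h2 : ∀ r, Tendsto (fun m => 1 - cos (((√(l m))⁻¹ • y) r)) atTop (𝓝 0) := by
            intro r
            have h3 : Tendsto (fun m => (√(l m))⁻¹ * y r) atTop (𝓝 0) := by
              simpa using hR.mul_const (y r)
            simpa using ((continuous_cos.tendsto 0).comp h3).const_sub 1
          simpa using tendsto_finsetSum (Finset.univ : Finset (Fin d)) fun r _ => h2 r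
        simpa using hk'.mul h1
      have hfin := tendsto_one_sub_pow_exp hx hnx
      rw [← exp_sum]
      simp only [neg_one_mul, Finset.sum_neg_distrib]
      refine hfin.congr' ?_
      filter_upwards [hbox] with m hm
      simp only [hG]
      rw [Set.indicator_of_mem hm]
  rw [integral_fintype_prod_volume_eq_pow (fun t : ℝ => exp (-1 * t ^ 2)), integral_gaussian,
    Fintype.card_fin, div_one] at hlim
  have hc : (2 * √π)⁻¹ ^ d = (2 * π)⁻¹ ^ d * √π ^ d := by
    rw [← mul_pow]
    congr 1
    have := sq_sqrt hpi.le
    field_simp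
    rw [this]
  rw [hc]
  refine (hlim.const_mul ((2 * π)⁻¹ ^ d)).congr' ?_
  filter_upwards [hl.eventually_gt_atTop 0] with m h0
  -- The Jacobian of the substitution supplies the factor √(n/k)^d.
  rw [Measure.integral_comp_smul, integral_indicator (measurableSet_torusBox d)]
  simp only [Module.finrank_fin_fun, inv_pow, inv_inv, smul_eq_mul]
  rw [abs_of_nonneg (by positivity)]
  ring

end EqualParts

/-! ### Finite probability: union bound, linearity, second moment, conditioning. -/

namespace EqualParts

section Prob

variable {α : Type}

lemma prob_eq (s : Finset α) (p : α → Prop) [DecidablePred p] :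
    prob s p = ((s.filter p).card : ℝ) / (s.card : ℝ) := by
  unfold prob
  congr!

lemma prob_nonneg (s : Finset α) (p : α → Prop) : 0 ≤ prob s p := by
  unfold prob; positivity

lemma prob_le_one (s : Finset α) (p : α → Prop) : prob s p ≤ 1 := by
  classical
  unfold prob
  refine div_le_one_of_le₀ ?_ (by positivity)
  exact_mod_cast Finset.card_filter_le _ _

lemma prob_mono {s : Finset α} {p q : α → Prop} (h : ∀ x ∈ s, p x → q x) :
    prob s p ≤ prob s q := by
  classical
  unfold prob
  gcongr 1
  exact_mod_cast Finset.card_le_card fun x hx => by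
    rw [Finset.mem_filter] at hx ⊢
    exact ⟨hx.1, h x hx.1 hx.2⟩

lemma prob_congr {s : Finset α} {p q : α → Prop} (h : ∀ x ∈ s, p x ↔ q x) :
    prob s p = prob s q :=
  le_antisymm (prob_mono fun x hx => (h x hx).1) (prob_mono fun x hx => (h x hx).2)

lemma prob_eq_one {s : Finset α} {p : α → Prop} (hs : s.Nonempty) (h : ∀ x ∈ s, p x) :
    prob s p = 1 := by
  classical
  unfold prob
  rw [Finset.filter_true_of_mem h, div_self]
  exact_mod_cast hs.card_pos.ne'

lemma prob_exists_le {ι : Type} (s : Finset α) (I : Finset ι) (p : ι → α → Prop) :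
    prob s (fun x => ∃ i ∈ I, p i x) ≤ ∑ i ∈ I, prob s (p i) := by
  classical
  unfold prob
  rw [← Finset.sum_div]
  gcongr
  norm_cast
  refine le_trans (Finset.card_le_card fun x hx => ?_) (Finset.card_biUnion_le
    (s := I) (t := fun i => s.filter (p i)))
  simp only [Finset.mem_filter, Finset.mem_biUnion] at hx ⊢
  obtain ⟨hx, i, hi, hp⟩ := hx
  exact ⟨i, hi, hx, hp⟩

lemma prob_and_not (s : Finset α) (p q : α → Prop) :
    prob s (fun x => p x ∧ ¬ q x) = prob s p - prob s (fun x => p x ∧ q x) := by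
  classical
  rw [prob_eq, prob_eq, prob_eq, ← sub_div]
  congr 1
  rw [eq_sub_iff_add_eq, add_comm]
  norm_cast
  rw [← Finset.filter_filter, ← Finset.filter_filter, Finset.card_filter_add_card_filter_not]

lemma expect_mono {s : Finset α} {X Y : α → ℕ} (h : ∀ x ∈ s, X x ≤ Y x) :
    expect s X ≤ expect s Y := by
  unfold expect
  gcongr with x hx
  exact_mod_cast h x hx

lemma expect_congr {s : Finset α} {X Y : α → ℕ} (h : ∀ x ∈ s, X x = Y x) :
    expect s X = expect s Y :=
  le_antisymm (expect_mono fun x hx => (h x hx).le) (expect_mono fun x hx => (h x hx).ge)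

lemma expect_add (s : Finset α) (X Y : α → ℕ) :
    expect s (fun x => X x + Y x) = expect s X + expect s Y := by
  unfold expect
  push_cast
  rw [Finset.sum_add_distrib, add_div]

/-- Linearity of expectation. Read from right to left it turns sums of probabilities into expected
counts, so that relations between such sums can be checked for each f separately. -/
lemma expect_card_filter {ι : Type} (s : Finset α) (I : Finset ι) (p : ι → α → Prop)
    [∀ x, DecidablePred fun i => p i x] :
    expect s (fun x => (I.filter fun i => p i x).card) = ∑ i ∈ I, prob s (p i) := by
  classical
  unfold expect
  simp_rw [prob_eq]
  rw [← Finset.sum_div]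
  congr 1
  simp_rw [Finset.card_filter]
  push_cast
  exact Finset.sum_comm

/-- The second-moment (Cauchy–Schwarz) lower bound for `P(X > 0)`. -/
lemma sq_expect_le (s : Finset α) (X : α → ℕ) :
    expect s X ^ 2 ≤ prob s (fun x => 0 < X x) * expect s (fun x => X x ^ 2) := by
  classical
  rw [prob_eq]
  unfold expect
  rw [div_pow, div_mul_div_comm, ← sq]
  gcongr
  have h1 : ∑ x ∈ s, (X x : ℝ) = ∑ x ∈ s, (if 0 < X x then (1 : ℝ) else 0) * X x := by
    refine Finset.sum_congr rfl fun x _ => ?_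
    split_ifs with h
    · simp
    · simp at h; simp [h]
  rw [h1]
  refine (Finset.sum_mul_sq_le_sq_mul_sq s _ _).trans (le_of_eq ?_)
  simp [Finset.sum_boole]

/-- Conditioning on a large subset changes probabilities little. -/
lemma abs_prob_sub_prob_le {s t : Finset α} (hst : s ⊆ t) (hs : s.Nonempty) (p : α → Prop) :
    |prob s p - prob t p| ≤ prob t (fun x => x ∉ s) := by
  classical
  have hA : ((t.filter p).card : ℝ) = (s.filter p).card + ((t \ s).filter p).card := by
    norm_cast
    rw [← Finset.card_union_of_disjoint, ← Finset.filter_union, Finset.union_sdiff_of_subset hst]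
    exact Finset.disjoint_filter_filter Finset.disjoint_sdiff
  have hT : (t.card : ℝ) = s.card + (t \ s).card := by
    norm_cast
    rw [add_comm, Finset.card_sdiff_add_card_eq_card hst]
  have hN : (t.filter fun x => x ∉ s) = t \ s := by ext; simp
  rw [prob_eq, prob_eq, prob_eq, hN, hA, hT]
  have hS : (0 : ℝ) < s.card := by exact_mod_cast hs.card_pos
  have h1 : ((s.filter p).card : ℝ) ≤ s.card := by exact_mod_cast Finset.card_filter_le _ _
  have h2 : (((t \ s).filter p).card : ℝ) ≤ (t \ s).card := by
    exact_mod_cast Finset.card_filter_le _ _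
  have h3 : (0 : ℝ) ≤ (s.filter p).card := by positivity
  have h4 : (0 : ℝ) ≤ ((t \ s).filter p).card := by positivity
  generalize ((s.filter p).card : ℝ) = A at *
  generalize (((t \ s).filter p).card : ℝ) = B at *
  generalize ((t \ s).card : ℝ) = N at *
  generalize (s.card : ℝ) = S at *
  have hN0 : 0 ≤ N := h4.trans h2
  -- With 0 ≤ A ≤ S and 0 ≤ B ≤ N the numerator is at most S N in absolute value.
  have : A / S - (A + B) / (S + N) = (A * N - B * S) / (S * (S + N)) := by
    field_simp; ring
  rw [this, abs_div, abs_of_pos (a := S * (S + N)) (by positivity), div_le_div_iff₀ (by positivity)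
    (by positivity), ← mul_assoc]
  gcongr
  rw [abs_le]
  constructor <;> nlinarith

end Prob

/-! ### Comparison of random surjections with random functions. -/

lemma mem_surjections {n k : ℕ} {f : Fin n → Fin k} : f ∈ surjections n k ↔ f.Surjective := by
  simp [surjections]

lemma surjections_nonempty {n k : ℕ} (hk : 1 ≤ k) (hkn : k ≤ n) : (surjections n k).Nonempty := by
  refine ⟨fun x => ⟨min x (k - 1), by omega⟩, mem_surjections.2 fun i => ⟨⟨i, by omega⟩, ?_⟩⟩
  ext
  simp
  omega

/-- Union bound over the missed value, each missed with probability (1 - 1/k)^n. -/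
lemma prob_not_surjective_le {n k : ℕ} (hk : 1 ≤ k) :
    prob Finset.univ (fun f : Fin n → Fin k => f ∉ surjections n k)
      ≤ k * Real.exp (-(n / k)) := by
  have h1 : prob Finset.univ (fun f : Fin n → Fin k => f ∉ surjections n k)
      ≤ ∑ i ∈ (Finset.univ : Finset (Fin k)),
        prob Finset.univ (fun f : Fin n → Fin k => ∀ x, f x ≠ i) := by
    refine le_trans (prob_mono fun f _ hf => ?_) (prob_exists_le _ _ _)
    rw [mem_surjections] at hf
    unfold Function.Surjective at hf
    push Not at hf
    simpa using hf
  have hk0 : (0 : ℝ) < k := by exact_mod_cast hk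
  have h2 : ∀ i : Fin k, prob Finset.univ (fun f : Fin n → Fin k => ∀ x, f x ≠ i)
      ≤ Real.exp (-(n / k)) := by
    intro i
    have hc : (Finset.univ.filter fun f : Fin n → Fin k => ∀ x, f x ≠ i)
        = Fintype.piFinset fun _ => Finset.univ.erase i := by
      ext f; simp [Fintype.mem_piFinset]
    have h3 : prob Finset.univ (fun f : Fin n → Fin k => ∀ x, f x ≠ i) = (1 - 1 / k) ^ n := by
      unfold prob
      have hcard : (Finset.univ.filter fun f : Fin n → Fin k => ∀ x, f x ≠ i).card
          = (k - 1) ^ n := by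
        rw [hc, Fintype.card_piFinset]
        simp
      rw [Finset.card_univ, Fintype.card_fun, Fintype.card_fin, Fintype.card_fin]
      rw [show 1 - 1 / (k : ℝ) = ((k - 1 : ℕ) : ℝ) / k by
        rw [Nat.cast_sub hk]; field_simp; simp, div_pow]
      rw [← Nat.cast_pow, ← hcard]
      push_cast
      congr!
    rw [h3]
    have h4 : 1 / (k : ℝ) ≤ 1 := by rw [div_le_one hk0]; exact_mod_cast hk
    calc (1 - 1 / (k : ℝ)) ^ n ≤ Real.exp (-(1 / k)) ^ n :=
          pow_le_pow_left₀ (by linarith) (Real.one_sub_le_exp_neg _) _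
      _ = _ := by rw [← Real.exp_nat_mul]; ring_nf
  refine h1.trans ((Finset.sum_le_sum fun i _ => h2 i).trans (le_of_eq ?_))
  simp

lemma abs_prob_surjections_sub_le {n k : ℕ} (hk : 1 ≤ k) (hkn : k ≤ n)
    (p : (Fin n → Fin k) → Prop) :
    |prob (surjections n k) p - prob Finset.univ p| ≤ k * Real.exp (-(n / k)) :=
  (abs_prob_sub_prob_le (Finset.subset_univ _) (surjections_nonempty hk hkn) p).trans
    (prob_not_surjective_le hk)

/-! ### From partitions to surjections through kernels. -/

lemma equalFibrePairs_pos_iff {n k : ℕ} (f : Fin n → Fin k) :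
    0 < equalFibrePairs f ↔ HasEqualFibres f := by
  simp [equalFibrePairs, HasEqualFibres, Finset.card_pos, Finset.filter_nonempty_iff]

lemma equalBlockPairs_pos_iff {n : ℕ} (P : Finpartition (Finset.univ : Finset (Fin n))) :
    0 < equalBlockPairs P ↔ HasEqualBlocks P := by
  rw [equalBlockPairs, HasEqualBlocks, Finset.card_pos, Finset.filter_nonempty_iff]
  constructor
  · rintro ⟨q, hq, h⟩
    rw [Finset.mem_powersetCard, Finset.card_eq_two] at hq
    obtain ⟨hq, B, C, hBC, rfl⟩ := hq
    exact ⟨B, hq (by simp), C, hq (by simp), hBC, h B (by simp) C (by simp)⟩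
  · rintro ⟨B, hB, C, hC, hBC, h⟩
    refine ⟨{B, C}, ?_, ?_⟩
    · rw [Finset.mem_powersetCard, Finset.card_pair hBC]
      refine ⟨?_, rfl⟩
      simp [Finset.insert_subset_iff, hB, hC]
    · simp [h]

open Classical in
/-- The kernel of `f`, as a partition of `[n]` into the non-empty fibres. -/
def kernelPartition {n k : ℕ} (f : Fin n → Fin k) :
    Finpartition (Finset.univ : Finset (Fin n)) :=
  Finpartition.ofSetoid (Setoid.ker f)

lemma mem_part_kernelPartition {n k : ℕ} (f : Fin n → Fin k) (x y : Fin n) :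
    y ∈ (kernelPartition f).part x ↔ f x = f y := by
  classical
  unfold kernelPartition
  rw [Finpartition.mem_part_ofSetoid_iff_rel, Setoid.ker_def]

lemma part_kernelPartition {n k : ℕ} (f : Fin n → Fin k) (x : Fin n) :
    (kernelPartition f).part x = Finset.univ.filter fun y => f y = f x := by
  ext y
  rw [mem_part_kernelPartition, Finset.mem_filter]
  simp [eq_comm]

lemma finpartition_eq_of_part_eq {n : ℕ} {P Q : Finpartition (Finset.univ : Finset (Fin n))}
    (h : ∀ x, P.part x = Q.part x) : P = Q := by
  have key : ∀ {P Q : Finpartition (Finset.univ : Finset (Fin n))}, (∀ x, P.part x = Q.part x) →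
      P.parts ⊆ Q.parts := by
    intro P Q h B hB
    obtain ⟨x, hx⟩ := P.nonempty_of_mem_parts hB
    rw [← P.part_eq_of_mem hB hx, h x]
    exact Q.part_mem.2 (Finset.mem_univ x)
  exact Finpartition.ext (Finset.Subset.antisymm (key h) (key fun x => (h x).symm))

lemma kernelPartition_eq_iff {n k : ℕ} (f g : Fin n → Fin k) :
    kernelPartition f = kernelPartition g ↔ ∀ x y, f x = f y ↔ g x = g y := by
  constructor
  · intro h x y
    rw [← mem_part_kernelPartition, ← mem_part_kernelPartition, h]
  · intro h
    refine finpartition_eq_of_part_eq fun x => ?_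
    ext y
    rw [mem_part_kernelPartition, mem_part_kernelPartition, h]

lemma parts_kernelPartition {n k : ℕ} {f : Fin n → Fin k} (hf : f.Surjective) :
    (kernelPartition f).parts
      = Finset.univ.image fun i : Fin k => Finset.univ.filter fun x => f x = i := by
  ext B
  simp only [Finset.mem_image, Finset.mem_univ, true_and]
  constructor
  · intro hB
    obtain ⟨x, hx⟩ := (kernelPartition f).nonempty_of_mem_parts hB
    exact ⟨f x, by rw [← part_kernelPartition, (kernelPartition f).part_eq_of_mem hB hx]⟩
  · rintro ⟨i, rfl⟩
    obtain ⟨x, rfl⟩ := hf i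
    rw [← part_kernelPartition]
    exact (kernelPartition f).part_mem.2 (Finset.mem_univ x)

lemma fibre_injective {n k : ℕ} {f : Fin n → Fin k} (hf : f.Surjective) :
    Function.Injective fun i : Fin k => (Finset.univ.filter fun x => f x = i : Finset (Fin n)) := by
  intro i j h
  obtain ⟨x, rfl⟩ := hf i
  have : x ∈ (Finset.univ.filter fun y => f y = j : Finset (Fin n)) := by
    simp only at h
    rw [← h]; simp
  simpa using this

lemma kernelPartition_mem {n k : ℕ} {f : Fin n → Fin k} (hf : f ∈ surjections n k) :
    kernelPartition f ∈ setPartitions n k := by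
  rw [mem_surjections] at hf
  rw [setPartitions, Finset.mem_filter, parts_kernelPartition hf,
    Finset.card_image_of_injective _ (fibre_injective hf)]
  simp

/-- The fibres of a surjection are distinct sets, so i < j corresponds to the two-element set of
their fibres. -/
lemma equalBlockPairs_kernelPartition {n k : ℕ} {f : Fin n → Fin k} (hf : f ∈ surjections n k) :
    equalBlockPairs (kernelPartition f) = equalFibrePairs f := by
  rw [mem_surjections] at hf
  symm
  unfold equalBlockPairs equalFibrePairs
  rw [parts_kernelPartition hf]
  set F : Fin k → Finset (Fin n) := fun i => Finset.univ.filter fun x => f x = i with hF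
  have hinj : F.Injective := fibre_injective hf
  refine Finset.card_bij (fun p _ => {F p.1, F p.2}) ?_ ?_ ?_
  · rintro ⟨i, j⟩ hp
    simp only [Finset.mem_filter, Finset.mem_univ, true_and] at hp
    have hs : (F i).card = (F j).card := hp.2
    rw [Finset.mem_filter, Finset.mem_powersetCard]
    refine ⟨⟨?_, Finset.card_pair (hinj.ne hp.1.ne)⟩, by simp [hs]⟩
    simp [Finset.insert_subset_iff]
  · rintro ⟨i, j⟩ hp ⟨u, v⟩ hq h
    simp only [Finset.mem_filter, Finset.mem_univ, true_and] at hp hq h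
    have h1 : i = u ∨ i = v := by
      have : F i ∈ ({F u, F v} : Finset (Finset (Fin n))) := by rw [← h]; simp
      simpa [hinj.eq_iff] using this
    have h2 : j = u ∨ j = v := by
      have : F j ∈ ({F u, F v} : Finset (Finset (Fin n))) := by rw [← h]; simp
      simpa [hinj.eq_iff] using this
    have h3 := hp.1
    have h4 := hq.1
    ext <;> simp only <;> omega
  · intro q hq
    rw [Finset.mem_filter, Finset.mem_powersetCard, Finset.card_eq_two] at hq
    obtain ⟨⟨hq, B, C, hBC, rfl⟩, h⟩ := hq
    obtain ⟨i, -, rfl⟩ := Finset.mem_image.1 (hq (Finset.mem_insert_self _ _))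
    obtain ⟨j, -, rfl⟩ := Finset.mem_image.1 (hq (Finset.mem_insert_of_mem
      (Finset.mem_singleton_self _)))
    have hij : i ≠ j := fun e => hBC (by rw [e])
    have hs : fibreSize f i = fibreSize f j := h (F i) (by simp) (F j) (by simp)
    rcases lt_or_gt_of_ne hij with hlt | hlt
    · exact ⟨(i, j), by simp [hlt, hs], rfl⟩
    · exact ⟨(j, i), by simp [hlt, hs], Finset.pair_comm _ _⟩

open Classical in
/-- Every partition into `k` blocks is the kernel of exactly `k!` surjections. -/
lemma card_kernelPartition_fiber {n k : ℕ} {P : Finpartition (Finset.univ : Finset (Fin n))}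
    (hP : P ∈ setPartitions n k) :
    ((surjections n k).filter fun f => kernelPartition f = P).card = k.factorial := by
  rw [setPartitions, Finset.mem_filter] at hP
  let e : P.parts ≃ Fin k := P.parts.equivFinOfCardEq hP.2
  let g : Fin n → Fin k := fun x => e ⟨P.part x, P.part_mem.2 (Finset.mem_univ x)⟩
  have hg : g.Surjective := by
    intro i
    obtain ⟨⟨B, hB⟩, rfl⟩ := e.surjective i
    obtain ⟨x, hx⟩ := P.nonempty_of_mem_parts hB
    refine ⟨x, ?_⟩
    simp only [g]
    congr 2
    exact P.part_eq_of_mem hB hx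
  have hgP : kernelPartition g = P := by
    refine finpartition_eq_of_part_eq fun x => ?_
    ext y
    rw [mem_part_kernelPartition, P.mem_part_iff_part_eq_part (Finset.mem_univ _)
      (Finset.mem_univ _)]
    simp [g, eq_comm]
  -- `g` labels the blocks by a fixed enumeration; every other surjection with kernel `P` relabels
  -- them by a unique permutation.
  have himg : ((surjections n k).filter fun f => kernelPartition f = P)
      = Finset.univ.image fun σ : Equiv.Perm (Fin k) => ⇑σ ∘ g := by
    ext f
    simp only [Finset.mem_filter, Finset.mem_image, Finset.mem_univ, true_and, mem_surjections]
    constructor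
    · rintro ⟨hf, hfP⟩
      rw [← hgP, kernelPartition_eq_iff] at hfP
      have hσ : ∀ x, f (Function.surjInv hg (g x)) = f x := fun x =>
        (hfP _ _).2 (Function.surjInv_eq hg (g x))
      have hbij : Function.Bijective (f ∘ Function.surjInv hg) := by
        rw [← Finite.surjective_iff_bijective]
        intro i
        obtain ⟨x, rfl⟩ := hf i
        exact ⟨g x, hσ x⟩
      exact ⟨Equiv.ofBijective _ hbij, funext fun x => hσ x⟩
    · rintro ⟨σ, rfl⟩
      refine ⟨σ.surjective.comp hg, ?_⟩
      rw [← hgP, kernelPartition_eq_iff]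
      simp
  rw [himg, Finset.card_image_of_injective, Finset.card_univ, Fintype.card_perm, Fintype.card_fin]
  intro σ τ h
  refine Equiv.ext fun i => ?_
  obtain ⟨x, rfl⟩ := hg i
  exact congrFun h x

/-- All kernels have k! preimages, so the kernel of a uniform surjection is a uniform partition. -/
lemma expect_setPartitions {n k : ℕ} (Y : Finpartition (Finset.univ : Finset (Fin n)) → ℕ) :
    expect (setPartitions n k) Y = expect (surjections n k) fun f => Y (kernelPartition f) := by
  classical
  have key : ∀ Z : Finpartition (Finset.univ : Finset (Fin n)) → ℝ,
      ∑ f ∈ surjections n k, Z (kernelPartition f)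
        = k.factorial * ∑ P ∈ setPartitions n k, Z P := by
    intro Z
    rw [← Finset.sum_fiberwise_of_maps_to (t := setPartitions n k) (g := kernelPartition)
      (fun f hf => kernelPartition_mem hf), Finset.mul_sum]
    refine Finset.sum_congr rfl fun P hP => ?_
    rw [← card_kernelPartition_fiber hP, ← nsmul_eq_mul, ← Finset.sum_const]
    refine Finset.sum_congr rfl fun f hf => ?_
    rw [(Finset.mem_filter.1 hf).2]
  have hcard := key fun _ => 1
  simp only [Finset.sum_const, nsmul_eq_mul, mul_one] at hcard
  unfold expect
  rw [key fun P => (Y P : ℝ), hcard, mul_div_mul_left]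
  exact_mod_cast k.factorial_ne_zero

lemma expect_equalBlockPairs (n k : ℕ) :
    expect (setPartitions n k) equalBlockPairs = expect (surjections n k) equalFibrePairs := by
  rw [expect_setPartitions]
  exact expect_congr fun f hf => equalBlockPairs_kernelPartition hf

open Classical in
lemma prob_eq_expect {α : Type} (s : Finset α) (p : α → Prop) :
    prob s p = expect s fun x => if p x then 1 else 0 := by
  unfold prob expect
  simp

lemma prob_hasEqualBlocks (n k : ℕ) :
    prob (setPartitions n k) HasEqualBlocks = prob (surjections n k) HasEqualFibres := by
  rw [prob_eq_expect, expect_setPartitions, prob_eq_expect]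
  refine expect_congr fun f hf => ?_
  congr 1
  rw [← equalBlockPairs_pos_iff, ← equalFibrePairs_pos_iff, equalBlockPairs_kernelPartition hf]

end EqualParts

/-! ### Forced coincidences, and the bound for one pair of fibres. -/

namespace EqualParts

lemma fibreSize_pos {n k : ℕ} {f : Fin n → Fin k} (hf : f ∈ surjections n k) (i : Fin k) :
    1 ≤ fibreSize f i := by
  rw [mem_surjections] at hf
  obtain ⟨x, hx⟩ := hf i
  exact Finset.card_pos.2 ⟨x, by simp [hx]⟩

lemma fibreSize_le {n k : ℕ} (f : Fin n → Fin k) (i : Fin k) : fibreSize f i ≤ n := by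
  simpa [fibreSize] using Finset.card_filter_le (Finset.univ : Finset (Fin n)) fun x => f x = i

lemma sum_fibreSize {n k : ℕ} (f : Fin n → Fin k) : ∑ i, fibreSize f i = n := by
  have := Finset.card_eq_sum_card_fiberwise (f := f) (s := Finset.univ) (t := Finset.univ)
    (by simp)
  simpa [fibreSize] using this.symm

/-- Distinct naturals sum to at least 0 + 1 + ⋯ + (card - 1); the induction removes the maximum. -/
lemma card_choose_two_le_sum (s : Finset ℕ) : s.card.choose 2 ≤ ∑ x ∈ s, x := by
  induction s using Finset.induction_on_max with
  | empty => simp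
  | insert a s ha ih =>
    have has : a ∉ s := fun h => lt_irrefl _ (ha a h)
    rw [Finset.card_insert_of_notMem has, Finset.sum_insert has, Nat.choose_succ_succ' s.card 1]
    have h : s ⊆ Finset.range a := fun x hx => Finset.mem_range.2 (ha x hx)
    have := Finset.card_le_card h
    simp at this ⊢
    omega

/-- Fewer than `1 + ⋯ + k` points cannot be split into `k` non-empty fibres of distinct sizes. -/
lemma hasEqualFibres_of_lt {n k : ℕ} (h : n < (k + 1).choose 2) {f : Fin n → Fin k}
    (hf : f ∈ surjections n k) : HasEqualFibres f := by
  by_contra hne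
  have hinj : Function.Injective (fibreSize f) := by
    intro i j hij
    by_contra hij'
    rcases lt_or_gt_of_ne hij' with hlt | hlt
    · exact hne ⟨i, j, hlt, hij⟩
    · exact hne ⟨j, i, hlt, hij.symm⟩
  have h0 : 0 ∉ Finset.univ.image (fibreSize f) := by
    simp only [Finset.mem_image, Finset.mem_univ, true_and, not_exists]
    intro i
    have := fibreSize_pos hf i
    omega
  -- Adding 0 to the k positive sizes gives k + 1 distinct naturals with the same sum n.
  have h1 := card_choose_two_le_sum (insert 0 (Finset.univ.image (fibreSize f)))
  rw [Finset.card_insert_of_notMem h0, Finset.card_image_of_injective _ hinj,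
    Finset.sum_insert h0, Finset.sum_image fun x _ y _ h => hinj h, sum_fibreSize] at h1
  simp at h1
  omega

/-- Serves the case k = 2, which the Fourier bound does not reach. The induction step rests on
(2m+1)(2m+3) ≤ 4(m+1)². -/
lemma centralBinom_sq_mul_le (m : ℕ) : m.centralBinom ^ 2 * (2 * m + 1) ≤ 16 ^ m := by
  induction m with
  | zero => simp
  | succ m ih =>
    have h := Nat.succ_mul_centralBinom_succ m
    refine Nat.le_of_mul_le_mul_left (c := (m + 1) ^ 2) ?_ (by positivity)
    calc (m + 1) ^ 2 * ((m + 1).centralBinom ^ 2 * (2 * (m + 1) + 1))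
        = ((m + 1) * (m + 1).centralBinom) ^ 2 * (2 * m + 3) := by ring
      _ = 4 * (2 * m + 1) * (2 * m + 3) * (m.centralBinom ^ 2 * (2 * m + 1)) := by rw [h]; ring
      _ ≤ 4 * (2 * m + 1) * (2 * m + 3) * 16 ^ m := Nat.mul_le_mul_left _ ih
      _ ≤ (16 * (m + 1) ^ 2) * 16 ^ m := Nat.mul_le_mul_right _ (by nlinarith)
      _ = _ := by ring

lemma prob_two_fibres_le {n : ℕ} (hn : 1 ≤ n) :
    prob Finset.univ (fun f : Fin n → Fin 2 => fibreSize f 0 = fibreSize f 1) ≤ √(1 / n) := by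
  have hn0 : (0 : ℝ) < n := by exact_mod_cast hn
  have hcard : (Finset.univ.filter fun f : Fin n → Fin 2 => fibreSize f 0 = fibreSize f 1).card ^ 2
      * n ≤ (2 ^ n) ^ 2 := by
    by_cases hev : ∃ m, n = 2 * m
    · obtain ⟨m, rfl⟩ := hev
      have h1 : (Finset.univ.filter fun f : Fin (2 * m) → Fin 2 =>
          fibreSize f 0 = fibreSize f 1).card ≤ m.centralBinom := by
        have h2 : m.centralBinom
            = ((Finset.univ : Finset (Fin (2 * m))).powersetCard m).card := by
          rw [Finset.card_powersetCard, Finset.card_univ, Fintype.card_fin, Nat.centralBinom]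
        rw [h2]
        refine Finset.card_le_card_of_injOn (fun f => Finset.univ.filter fun x => f x = 0) ?_ ?_
        · intro f hf
          simp only [Finset.coe_filter, Finset.mem_univ, true_and, Set.mem_ofPred_eq] at hf
          have h3 := sum_fibreSize f
          rw [Fin.sum_univ_two] at h3
          simp only [Finset.mem_coe, Finset.mem_powersetCard, Finset.subset_univ, true_and]
          change fibreSize f 0 = m
          omega
        · intro f _ g _ h
          funext x
          have := congrArg (x ∈ ·) h
          simp at this
          omega
      calc _ ≤ m.centralBinom ^ 2 * (2 * m + 1) := Nat.mul_le_mul (Nat.pow_le_pow_left h1 2) (by omega)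
        _ ≤ 16 ^ m := centralBinom_sq_mul_le m
        _ = _ := by rw [← pow_mul, show 2 * m * 2 = 4 * m by ring, pow_mul]; norm_num
    · have h1 : (Finset.univ.filter fun f : Fin n → Fin 2 => fibreSize f 0 = fibreSize f 1) = ∅ := by
        refine Finset.filter_eq_empty_iff.2 fun f _ h => hev ⟨fibreSize f 0, ?_⟩
        have h3 := sum_fibreSize f
        rw [Fin.sum_univ_two] at h3
        omega
      simp [h1]
  rw [prob_eq]
  apply Real.le_sqrt_of_sq_le
  rw [div_pow, div_le_div_iff₀ (by simp) hn0, one_mul]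
  simp only [Finset.card_univ, Fintype.card_fun, Fintype.card_fin]
  exact_mod_cast hcard

/-- Two given fibres are of the same size with probability `O(√(k / n))`, for every `k`. -/
lemma prob_pair_le {n k : ℕ} (hn : 1 ≤ n) {i j : Fin k} (hij : i < j) :
    prob Finset.univ (fun f : Fin n → Fin k => fibreSize f i = fibreSize f j)
      ≤ √(Real.pi * 3 * (k / n)) := by
  have hn0 : (0 : ℝ) < n := by exact_mod_cast hn
  -- When n/k⁵ → ∞ the sequence k may stay bounded, so small k cannot be discarded; i < j leaves
  -- only k = 2.
  by_cases hk : 3 ≤ k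
  · have h := prob_star_le (d := 1) hn hk ![i, j] (by
      intro x y; fin_cases x <;> fin_cases y <;> simp [hij.ne, hij.ne'])
    refine le_trans (prob_mono fun f _ hf => ?_) (h.trans (le_of_eq ?_))
    · intro r; fin_cases r; simpa using hf.symm
    · norm_num
  · have hk2 : k = 2 := by omega
    subst hk2
    have hi : i = 0 := by omega
    have hj : j = 1 := by omega
    subst hi hj
    refine (prob_two_fibres_le hn).trans (Real.sqrt_le_sqrt ?_)
    rw [div_le_iff₀ hn0]
    field_simp
    norm_num
    linarith [Real.pi_gt_three]

/-! ### Counting pairs of pairs. -/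

/-- The pairs `i < j`. -/
def ltPairs (k : ℕ) : Finset (Fin k × Fin k) := Finset.univ.filter fun p => p.1 < p.2

/-- No entry of `p` is an entry of `q`. -/
def DisjointPairs {k : ℕ} (p q : Fin k × Fin k) : Prop :=
  p.1 ≠ q.1 ∧ p.1 ≠ q.2 ∧ p.2 ≠ q.1 ∧ p.2 ≠ q.2

instance {k : ℕ} (p q : Fin k × Fin k) : Decidable (DisjointPairs p q) := by
  unfold DisjointPairs; infer_instance

/-- The ordered pairs of disjoint pairs. -/
def quads (k : ℕ) : Finset ((Fin k × Fin k) × (Fin k × Fin k)) :=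
  (ltPairs k ×ˢ ltPairs k).filter fun c => DisjointPairs c.1 c.2

/-- The ordered pairs of pairs with a common entry. -/
def overlaps (k : ℕ) : Finset ((Fin k × Fin k) × (Fin k × Fin k)) :=
  (ltPairs k ×ˢ ltPairs k).filter fun c => ¬ DisjointPairs c.1 c.2

lemma mem_ltPairs {k : ℕ} {p : Fin k × Fin k} : p ∈ ltPairs k ↔ p.1 < p.2 := by
  simp [ltPairs]

lemma mem_quads {k : ℕ} {c : (Fin k × Fin k) × (Fin k × Fin k)} :
    c ∈ quads k ↔ (c.1 ∈ ltPairs k ∧ c.2 ∈ ltPairs k) ∧ DisjointPairs c.1 c.2 := by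
  simp [quads]

lemma mem_overlaps {k : ℕ} {c : (Fin k × Fin k) × (Fin k × Fin k)} :
    c ∈ overlaps k ↔ (c.1 ∈ ltPairs k ∧ c.2 ∈ ltPairs k) ∧ ¬ DisjointPairs c.1 c.2 := by
  simp [overlaps]

lemma two_mul_card_filter_lt {k : ℕ} (s : Finset (Fin k)) :
    2 * ((s ×ˢ s).filter fun p => p.1 < p.2).card = s.card * (s.card - 1) := by
  have h1 : ((s ×ˢ s).filter fun p => p.1 < p.2).card
      = ((s ×ˢ s).filter fun p => p.2 < p.1).card := by
    refine Finset.card_bij (fun p _ => p.swap) ?_ ?_ ?_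
    · intro p; simp; tauto
    · intro p _ q _ h; exact Prod.swap_injective h
    · intro p hp; exact ⟨p.swap, by simp at hp ⊢; tauto, by simp⟩
  have h2 : s.offDiag = ((s ×ˢ s).filter fun p => p.1 < p.2)
      ∪ ((s ×ˢ s).filter fun p => p.2 < p.1) := by
    ext ⟨i, j⟩
    simp only [Finset.mem_offDiag, Finset.mem_union, Finset.mem_filter, Finset.mem_product]
    rw [ne_iff_lt_or_gt]
    tauto
  have h3 := s.offDiag_card
  rw [h2, Finset.card_union_of_disjoint, ← h1] at h3
  · rw [two_mul, h3, Nat.mul_sub, mul_one]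
  · rw [Finset.disjoint_left]
    intro p hp hq
    simp only [Finset.mem_filter] at hp hq
    exact lt_asymm hp.2 hq.2

lemma two_mul_card_ltPairs (k : ℕ) : 2 * (ltPairs k).card = k * (k - 1) := by
  have := two_mul_card_filter_lt (Finset.univ : Finset (Fin k))
  simpa [ltPairs] using this

lemma two_mul_card_quads (k : ℕ) : 2 * (quads k).card = (ltPairs k).card * ((k - 2) * (k - 3)) := by
  have h1 : ∀ p ∈ ltPairs k, 2 * ((ltPairs k).filter fun q => DisjointPairs p q).card
      = (k - 2) * (k - 3) := by
    intro p hp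
    simp only [ltPairs, Finset.mem_filter, Finset.mem_univ, true_and] at hp
    -- For fixed p, the pair q is chosen among the k - 2 remaining values.
    have h2 := two_mul_card_filter_lt (Finset.univ \ {p.1, p.2})
    rw [Finset.card_sdiff_of_subset (Finset.subset_univ _), Finset.card_pair hp.ne,
      Finset.card_univ, Fintype.card_fin, Nat.sub_sub] at h2
    rw [← h2]
    congr 2
    ext q
    simp [ltPairs, DisjointPairs, eq_comm]
    tauto
  rw [quads, Finset.card_filter, Finset.sum_product, Finset.mul_sum]
  simp_rw [← Finset.card_filter]
  rw [Finset.sum_congr rfl h1]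
  simp

lemma card_quads_add_card_overlaps (k : ℕ) :
    (quads k).card + (overlaps k).card = (ltPairs k).card ^ 2 := by
  rw [quads, overlaps, Finset.card_filter_add_card_filter_not, Finset.card_product, sq]

/-- The order k³, one below that of `quads`, is what matters. Small k is separate only because of
truncated subtraction. -/
lemma card_overlaps_le (k : ℕ) : (overlaps k).card ≤ k ^ 3 := by
  have h1 := two_mul_card_ltPairs k
  have h2 := two_mul_card_quads k
  have h3 := card_quads_add_card_overlaps k
  rcases lt_or_ge k 3 with hk | hk
  · have : (ltPairs k).card ^ 2 ≤ k ^ 3 := by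
      have hlt : k = 0 ∨ k = 1 ∨ k = 2 := by omega
      rcases hlt with rfl | rfl | rfl
      · have : (ltPairs 0).card = 0 := by omega
        simp [this]
      · have : (ltPairs 1).card = 0 := by omega
        simp [this]
      · have : (ltPairs 2).card = 1 := by omega
        simp [this]
    omega
  · obtain ⟨m, rfl⟩ := Nat.exists_eq_add_of_le hk
    rw [show 3 + m - 1 = m + 2 by omega] at h1
    rw [show 3 + m - 2 = m + 1 by omega, show 3 + m - 3 = m by omega] at h2
    nlinarith

/-! ### The second moment and its decomposition. -/

lemma equalFibrePairs_eq {n k : ℕ} (f : Fin n → Fin k) :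
    equalFibrePairs f = ((ltPairs k).filter fun p => fibreSize f p.1 = fibreSize f p.2).card := by
  rw [equalFibrePairs, ltPairs, Finset.filter_filter]

lemma expect_equalFibrePairs (n k : ℕ) :
    expect (surjections n k) equalFibrePairs
      = ∑ p ∈ ltPairs k, prob (surjections n k) (fun f => fibreSize f p.1 = fibreSize f p.2) := by
  classical
  rw [← expect_card_filter]
  refine expect_congr fun f _ => ?_
  rw [equalFibrePairs_eq]

lemma mem_indices {n k : ℕ} {a : (Fin k × Fin k) × ℕ} :
    a ∈ indices n k ↔ a.1 ∈ ltPairs k ∧ 1 ≤ a.2 ∧ a.2 ≤ n := by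
  simp [indices, ltPairs]

lemma coincide_iff {n k : ℕ} {a : (Fin k × Fin k) × ℕ} {f : Fin n → Fin k} :
    coincide a f ↔ a.2 = fibreSize f a.1.1 ∧ fibreSize f a.1.1 = fibreSize f a.1.2 := by
  unfold coincide
  constructor <;> rintro ⟨h1, h2⟩ <;> constructor <;> omega

-- The size t is determined by f and the pair; surjectivity ensures t ≥ 1, as `indices` demands.
open Classical in
lemma card_filter_coincide {n k : ℕ} {f : Fin n → Fin k} (hf : f ∈ surjections n k) :
    ((indices n k).filter fun a => coincide a f).card = equalFibrePairs f := by
  rw [equalFibrePairs_eq]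
  symm
  refine Finset.card_bij (fun p _ => (p, fibreSize f p.1)) ?_ ?_ ?_
  · intro p hp
    rw [Finset.mem_filter] at hp
    rw [Finset.mem_filter, mem_indices, coincide_iff]
    exact ⟨⟨hp.1, fibreSize_pos hf _, fibreSize_le f _⟩, rfl, hp.2⟩
  · intro p _ q _ h
    exact (Prod.ext_iff.1 h).1
  · rintro ⟨p, t⟩ ha
    rw [Finset.mem_filter, mem_indices, coincide_iff] at ha
    exact ⟨p, Finset.mem_filter.2 ⟨ha.1.1, ha.2.2⟩, Prod.ext rfl ha.2.1.symm⟩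

/-- The denominator is the second moment of the number of pairs of fibres of equal size. -/
lemma secondMomentDenominator_eq (n k : ℕ) :
    secondMomentDenominator n k
      = expect (surjections n k) (fun f => equalFibrePairs f ^ 2) := by
  classical
  unfold secondMomentDenominator
  rw [← expect_card_filter, ← expect_card_filter, ← expect_add]
  refine expect_congr fun f hf => ?_
  -- For fixed f with X occurring events, the diagonal gives X and the ordered pairs give X² - X.
  have h : ((indices n k).offDiag.filter fun c => coincide c.1 f ∧ coincide c.2 f)
      = ((indices n k).filter fun a => coincide a f).offDiag := by
    ext c
    simp only [Finset.mem_filter, Finset.mem_offDiag]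
    tauto
  rw [h, Finset.offDiag_card, card_filter_coincide hf, sq]
  have := Nat.le_mul_self (equalFibrePairs f)
  omega

/-- The sizes l and t are read off from f, so summing over l ≠ t leaves only the condition that the
two common sizes differ. -/
lemma secondMomentMainTerm_eq (n k : ℕ) :
    secondMomentMainTerm n k = ∑ c ∈ quads k, prob (surjections n k) (fun f =>
      (fibreSize f c.1.1 = fibreSize f c.1.2 ∧ fibreSize f c.2.1 = fibreSize f c.2.2)
        ∧ ¬ fibreSize f c.1.1 = fibreSize f c.2.1) := by
  classical
  unfold secondMomentMainTerm
  rw [← expect_card_filter, ← expect_card_filter]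
  refine expect_congr fun f hf => ?_
  symm
  refine Finset.card_bij (fun c _ => ((c.1, fibreSize f c.1.1), (c.2, fibreSize f c.2.1))) ?_ ?_ ?_
  · rintro ⟨p, q⟩ hc
    simp only [Finset.mem_filter, mem_quads, DisjointPairs] at hc
    simp only [Finset.mem_filter, Finset.mem_offDiag, mem_indices, coincide_iff]
    refine ⟨⟨⟨⟨hc.1.1.1, fibreSize_pos hf _, fibreSize_le f _⟩,
      ⟨hc.1.1.2, fibreSize_pos hf _, fibreSize_le f _⟩, fun h => hc.2.2 (Prod.ext_iff.1 h).2⟩,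
      hc.1.2.1, hc.1.2.2.1, hc.1.2.2.2.1, hc.1.2.2.2.2, hc.2.2⟩, ⟨trivial, hc.2.1.1⟩, trivial,
      hc.2.1.2⟩
  · intro c _ d _ h
    simp only [Prod.mk.injEq] at h
    exact Prod.ext h.1.1 h.2.1
  · rintro ⟨⟨p, l⟩, ⟨q, t⟩⟩ hc
    simp only [Finset.mem_filter, Finset.mem_offDiag, mem_indices, coincide_iff] at hc
    obtain ⟨⟨⟨h1, h2, -⟩, h3, h4, h5, h6, h7⟩, ⟨rfl, h8⟩, rfl, h9⟩ := hc
    refine ⟨(p, q), ?_, rfl⟩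
    simp only [Finset.mem_filter, mem_quads, DisjointPairs]
    exact ⟨⟨⟨h1.1, h2.1⟩, h3, h4, h5, h6⟩, ⟨h8, h9⟩, h7⟩

/-- The fibres over all entries of `p` and `q` have the same size. -/
def AllEqual {n k : ℕ} (c : (Fin k × Fin k) × (Fin k × Fin k)) (f : Fin n → Fin k) : Prop :=
  (fibreSize f c.1.1 = fibreSize f c.1.2 ∧ fibreSize f c.2.1 = fibreSize f c.2.2)
    ∧ fibreSize f c.1.1 = fibreSize f c.2.1

lemma secondMomentDenominator_sub_nonneg (n k : ℕ) :
    0 ≤ secondMomentDenominator n k - secondMomentMainTerm n k := by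
  unfold secondMomentDenominator secondMomentMainTerm
  have h1 := Finset.sum_le_sum_of_subset_of_nonneg (Finset.filter_subset (fun c =>
      c.1.1.1 ≠ c.2.1.1 ∧ c.1.1.1 ≠ c.2.1.2 ∧ c.1.1.2 ≠ c.2.1.1 ∧ c.1.1.2 ≠ c.2.1.2 ∧
        c.1.2 ≠ c.2.2) (indices n k).offDiag) fun c _ _ => prob_nonneg (surjections n k)
          (fun f => coincide c.1 f ∧ coincide c.2 f)
  have h2 := Finset.sum_nonneg fun (a : (Fin k × Fin k) × ℕ) (_ : a ∈ indices n k) =>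
    prob_nonneg (surjections n k) (coincide a)
  linarith

/-- Outside the main term either the pairs are disjoint and l = t, or they share an entry, which
forces l = t as well; since the indices differ, overlapping pairs must then be different. -/
lemma secondMomentDenominator_sub_le (n k : ℕ) :
    secondMomentDenominator n k - secondMomentMainTerm n k
      ≤ expect (surjections n k) equalFibrePairs
        + (∑ c ∈ (overlaps k).filter (fun c => c.1 ≠ c.2), prob (surjections n k) (AllEqual c)
          + ∑ c ∈ quads k, prob (surjections n k) (AllEqual c)) := by
  classical
  unfold secondMomentDenominator secondMomentMainTerm
  set Q : ((Fin k × Fin k) × ℕ) × ((Fin k × Fin k) × ℕ) → Prop := fun c =>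
      c.1.1.1 ≠ c.2.1.1 ∧ c.1.1.1 ≠ c.2.1.2 ∧ c.1.1.2 ≠ c.2.1.1 ∧ c.1.1.2 ≠ c.2.1.2 ∧
        c.1.2 ≠ c.2.2 with hQ
  have hsplit := Finset.sum_filter_add_sum_filter_not (indices n k).offDiag Q
    fun c => prob (surjections n k) (fun f => coincide c.1 f ∧ coincide c.2 f)
  have h1 : ∑ a ∈ indices n k, prob (surjections n k) (coincide a)
      = expect (surjections n k) equalFibrePairs := by
    rw [← expect_card_filter]
    exact expect_congr fun f hf => card_filter_coincide hf
  have h2 : ∑ c ∈ (indices n k).offDiag.filter (fun c => ¬ Q c),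
      prob (surjections n k) (fun f => coincide c.1 f ∧ coincide c.2 f)
      ≤ ∑ c ∈ (overlaps k).filter (fun c => c.1 ≠ c.2), prob (surjections n k) (AllEqual c)
          + ∑ c ∈ quads k, prob (surjections n k) (AllEqual c) := by
    rw [← expect_card_filter, ← expect_card_filter, ← expect_card_filter, ← expect_add]
    refine expect_mono fun f hf => ?_
    rw [← Finset.card_union_of_disjoint]
    · refine Finset.card_le_card_of_injOn (fun c => (c.1.1, c.2.1)) ?_ ?_
      · rintro ⟨⟨p, l⟩, ⟨q, t⟩⟩ hc
        simp only [Finset.coe_filter, Set.mem_ofPred_eq, Finset.mem_filter, Finset.mem_offDiag,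
          mem_indices, coincide_iff, hQ] at hc
        obtain ⟨⟨⟨h1, h2, h0⟩, h3⟩, ⟨rfl, h8⟩, rfl, h9⟩ := hc
        simp only [Finset.mem_coe, Finset.mem_union,
          Finset.mem_filter, mem_overlaps, mem_quads]
        by_cases hd : DisjointPairs p q
        · right
          refine ⟨⟨⟨h1.1, h2.1⟩, hd⟩, ⟨h8, h9⟩, ?_⟩
          by_contra hne
          exact h3 ⟨hd.1, hd.2.1, hd.2.2.1, hd.2.2.2, hne⟩
        · left
          refine ⟨⟨⟨⟨h1.1, h2.1⟩, hd⟩, ?_⟩, ⟨h8, h9⟩, ?_⟩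
          · rintro rfl; exact h0 rfl
          · unfold DisjointPairs at hd
            by_contra hne
            apply hd
            refine ⟨fun e => hne ?_, fun e => hne ?_, fun e => hne ?_, fun e => hne ?_⟩
            · rw [e]
            · rw [e, h9]
            · rw [h8, e]
            · rw [h8, e, h9]
      · rintro ⟨⟨p, l⟩, ⟨q, t⟩⟩ hc ⟨⟨p', l'⟩, ⟨q', t'⟩⟩ hc' h
        simp only [Finset.coe_filter, Set.mem_ofPred_eq, coincide_iff] at hc hc'
        simp only [Prod.mk.injEq] at h
        obtain ⟨rfl, rfl⟩ := h
        obtain ⟨-, ⟨rfl, -⟩, rfl, -⟩ := hc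
        obtain ⟨-, ⟨rfl, -⟩, rfl, -⟩ := hc'
        rfl
    · rw [Finset.disjoint_left]
      intro c hc hc'
      simp only [Finset.mem_filter, mem_overlaps, mem_quads] at hc hc'
      exact hc.1.1.2 hc'.1.2
  rw [h1]
  linarith

/-! ### Coincidences among three or four fibres. -/

lemma prob_allEqual_of_quad {n k : ℕ} (hn : 1 ≤ n) (hk : 5 ≤ k)
    {c : (Fin k × Fin k) × (Fin k × Fin k)} (hc : c ∈ quads k) :
    prob Finset.univ (AllEqual (n := n) c) ≤ √(Real.pi * 5 * (k / n)) ^ 3 := by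
  obtain ⟨⟨i, j⟩, ⟨u, v⟩⟩ := c
  simp only [mem_quads, mem_ltPairs, DisjointPairs] at hc
  obtain ⟨⟨h1, h2⟩, h3, h4, h5, h6⟩ := hc
  have h := prob_star_le (d := 3) hn hk ![i, j, u, v] (by
    intro x y
    fin_cases x <;> fin_cases y <;>
      simp [h1.ne, h2.ne, h1.ne', h2.ne', h3, h4, h5, h6, h3.symm, h4.symm, h5.symm, h6.symm])
  refine le_trans (prob_mono fun f _ hf => ?_) (h.trans (le_of_eq (by norm_num)))
  obtain ⟨⟨e1, e2⟩, e3⟩ := hf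
  simp only at e1 e2 e3
  intro r
  fin_cases r
  · simpa using e1.symm
  · simpa using e3.symm
  · simpa using (e3.trans e2).symm

lemma prob_triple_le {n k : ℕ} (hn : 1 ≤ n) (hk : 4 ≤ k) {i j u : Fin k} (hij : i ≠ j) (hiu : i ≠ u)
    (hju : j ≠ u) :
    prob Finset.univ (fun f : Fin n → Fin k => fibreSize f j = fibreSize f i ∧
      fibreSize f u = fibreSize f i) ≤ √(Real.pi * 4 * (k / n)) ^ 2 := by
  have h := prob_star_le (d := 2) hn hk ![i, j, u] (by
    intro x y
    fin_cases x <;> fin_cases y <;> simp [hij, hiu, hju, hij.symm, hiu.symm, hju.symm])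
  refine le_trans (prob_mono fun f _ hf => ?_) (h.trans (le_of_eq (by norm_num)))
  intro r
  fin_cases r
  · simpa using hf.1
  · simpa using hf.2

lemma prob_allEqual_of_overlap {n k : ℕ} (hn : 1 ≤ n) (hk : 4 ≤ k)
    {c : (Fin k × Fin k) × (Fin k × Fin k)} (hc : c ∈ (overlaps k).filter (fun c => c.1 ≠ c.2)) :
    prob Finset.univ (AllEqual (n := n) c) ≤ √(Real.pi * 4 * (k / n)) ^ 2 := by
  obtain ⟨⟨i, j⟩, ⟨u, v⟩⟩ := c
  simp only [Finset.mem_filter, mem_overlaps, mem_ltPairs, ne_eq, Prod.mk.injEq] at hc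
  obtain ⟨⟨⟨h1, h2⟩, h3⟩, h4⟩ := hc
  by_cases huj : u ≠ i ∧ u ≠ j
  · refine le_trans (prob_mono fun f _ hf => ?_)
      (prob_triple_le hn hk h1.ne huj.1.symm huj.2.symm)
    obtain ⟨⟨e1, e2⟩, e3⟩ := hf
    exact ⟨e1.symm, e3.symm⟩
  -- Two different increasing pairs cannot have both u and v in {i, j}, so a third fibre is always
  -- available.
  · have hv : v ≠ i ∧ v ≠ j := by
      constructor <;> rintro rfl <;> omega
    refine le_trans (prob_mono fun f _ hf => ?_)
      (prob_triple_le hn hk h1.ne hv.1.symm hv.2.symm)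
    obtain ⟨⟨e1, e2⟩, e3⟩ := hf
    exact ⟨e1.symm, (e3.trans e2).symm⟩

end EqualParts

/-! ### Asymptotics of the moments and the two regimes. -/

namespace EqualParts

open Real

/-- The Fourier integral for the probability that `d` disjoint pairs of fibres are of equal size. -/
def pairsIntegral (d n k : ℕ) : ℝ :=
  (2 * π)⁻¹ ^ d * ∫ θ in torusBox d, (1 - 2 / k * ∑ r, (1 - cos (θ r))) ^ n

/-- A bound for the probability that a random function is not surjective. -/
def surjError (n k : ℕ) : ℝ := k * exp (-(n / k))

lemma surjError_nonneg (n k : ℕ) : 0 ≤ surjError n k := by unfold surjError; positivity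

lemma abs_prob_pair_sub_le {n k : ℕ} (hk : 1 ≤ k) (hkn : k ≤ n) {p : Fin k × Fin k}
    (hp : p ∈ ltPairs k) :
    |prob (surjections n k) (fun f => fibreSize f p.1 = fibreSize f p.2) - pairsIntegral 1 n k|
      ≤ surjError n k := by
  rw [mem_ltPairs] at hp
  have h := prob_pairs_eq_integral (n := n) hk ![p.1] ![p.2] (by
    rintro (x | x) (y | y) <;> fin_cases x <;> fin_cases y <;> simp [hp.ne, hp.ne'])
  rw [pairsIntegral, ← h]
  have h2 : (fun f : Fin n → Fin k => ∀ r : Fin 1, fibreSize f (![p.1] r) = fibreSize f (![p.2] r))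
      = fun f => fibreSize f p.1 = fibreSize f p.2 := by
    funext f; simp
  rw [h2]
  exact abs_prob_surjections_sub_le hk hkn _

lemma abs_prob_quad_sub_le {n k : ℕ} (hk : 5 ≤ k) (hkn : k ≤ n)
    {c : (Fin k × Fin k) × (Fin k × Fin k)} (hc : c ∈ quads k) :
    |prob (surjections n k) (fun f =>
      (fibreSize f c.1.1 = fibreSize f c.1.2 ∧ fibreSize f c.2.1 = fibreSize f c.2.2)
        ∧ ¬ fibreSize f c.1.1 = fibreSize f c.2.1) - pairsIntegral 2 n k|
      ≤ 2 * surjError n k + √(π * 5 * (k / n)) ^ 3 := by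
  have h4 := prob_allEqual_of_quad (n := n) (by omega) hk hc
  have h4' := abs_le.1 (abs_prob_surjections_sub_le (by omega) hkn (AllEqual (n := n) c))
  have h4n := prob_nonneg (surjections n k) (AllEqual (n := n) c)
  have hc' := hc
  simp only [mem_quads, mem_ltPairs, DisjointPairs] at hc'
  obtain ⟨⟨h1, h2⟩, h3, h4, h5, h6⟩ := hc'
  have h := prob_pairs_eq_integral (n := n) (by omega) ![c.1.1, c.2.1] ![c.1.2, c.2.2] (by
    rintro (x | x) (y | y) <;> fin_cases x <;> fin_cases y <;>
      simp [h1.ne, h2.ne, h1.ne', h2.ne', h3, h4, h5, h6, h3.symm, h4.symm, h5.symm, h6.symm])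
  have h2 : (fun f : Fin n → Fin k => ∀ r : Fin 2,
      fibreSize f (![c.1.1, c.2.1] r) = fibreSize f (![c.1.2, c.2.2] r))
      = fun f => fibreSize f c.1.1 = fibreSize f c.1.2 ∧ fibreSize f c.2.1 = fibreSize f c.2.2 := by
    funext f; simp [Fin.forall_fin_two]
  rw [prob_and_not, pairsIntegral, ← h, h2]
  -- The surjection error enters twice: for the two equalities, and for the event that all four
  -- sizes agree, which is subtracted.
  have h7 := abs_le.1 (abs_prob_surjections_sub_le (by omega) hkn (fun f : Fin n → Fin k =>
    fibreSize f c.1.1 = fibreSize f c.1.2 ∧ fibreSize f c.2.1 = fibreSize f c.2.2))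
  change |_ - prob (surjections n k) (AllEqual c) - _| ≤ _
  have h8 := surjError_nonneg n k
  have h9 : 0 ≤ √(π * 5 * (k / n)) ^ 3 := by positivity
  unfold surjError at *
  rw [abs_le]
  constructor <;> linarith

lemma abs_sum_sub_card_mul_le {ι : Type} (I : Finset ι) (P : ι → ℝ) {x e : ℝ}
    (h : ∀ c ∈ I, |P c - x| ≤ e) : |∑ c ∈ I, P c - I.card * x| ≤ I.card * e := by
  rw [← nsmul_eq_mul, ← Finset.sum_const, ← Finset.sum_sub_distrib]
  refine (Finset.abs_sum_le_sum_abs _ _).trans ((Finset.sum_le_sum h).trans (le_of_eq ?_))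
  simp

/-- Common to both moments: T is a sum of N probabilities, each within e of I; K is the order of N,
and w the inverse order of I. -/
lemma tendsto_of_sum_approx {T N K w I e : ℕ → ℝ} {ν ι : ℝ}
    (hT : ∀ᶠ m in atTop, |T m - N m * I m| ≤ N m * e m) (hw : ∀ m, 0 ≤ w m) (hK : ∀ m, 0 ≤ K m)
    (hN : Tendsto (fun m => N m / K m) atTop (𝓝 ν)) (hI : Tendsto (fun m => w m * I m) atTop (𝓝 ι))
    (he : Tendsto (fun m => w m * e m) atTop (𝓝 0)) :
    Tendsto (fun m => w m * (T m / K m)) atTop (𝓝 (ν * ι)) := by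
  have h1 : Tendsto (fun m => w m * ((T m - N m * I m) / K m)) atTop (𝓝 0) := by
    have h2 : Tendsto (fun m => N m / K m * (w m * e m)) atTop (𝓝 0) := by
      simpa using hN.mul he
    refine squeeze_zero_norm' ?_ h2
    filter_upwards [hT] with m hm
    rw [norm_mul, norm_div, Real.norm_of_nonneg (hw m), Real.norm_of_nonneg (hK m), Real.norm_eq_abs]
    calc w m * (|T m - N m * I m| / K m) ≤ w m * (N m * e m / K m) := by
          have := hw m; have := hK m; gcongr
      _ = _ := by ring
  have h3 := (hN.mul hI).add h1
  rw [add_zero] at h3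
  refine h3.congr fun m => ?_
  ring

section Regime

variable {n k : ℕ → ℕ}

lemma eventually_le_of_choose_le (hn : ∀ m, (k m + 1).choose 2 ≤ n m) (hk : Tendsto k atTop atTop) :
    ∀ᶠ m in atTop, 1 ≤ k m ∧ k m ≤ n m ∧ ((k m : ℝ) + 1) / 2 ≤ n m / k m := by
  filter_upwards [hk.eventually_ge_atTop 1] with m hm
  have h1 := hn m
  have h3 : k m * (k m + 1) ≤ 2 * n m := by
    rw [Nat.choose_two_right, Nat.add_sub_cancel] at h1
    have h4 : 2 ∣ (k m + 1) * k m := by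
      rw [mul_comm]; exact (Nat.even_mul_succ_self (k m)).two_dvd
    have := Nat.div_mul_cancel h4
    nlinarith
  refine ⟨hm, by nlinarith, ?_⟩
  have hk0 : (0 : ℝ) < k m := by exact_mod_cast hm
  rw [div_le_div_iff₀ (by norm_num) hk0]
  have h5 : ((k m * (k m + 1) : ℕ) : ℝ) ≤ ((2 * n m : ℕ) : ℝ) := by exact_mod_cast h3
  push_cast at h5
  linarith

lemma tendsto_ratio (hn : ∀ m, (k m + 1).choose 2 ≤ n m) (hk : Tendsto k atTop atTop) :
    Tendsto (fun m => (n m : ℝ) / k m) atTop atTop := by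
  refine tendsto_atTop_mono' atTop (f₁ := fun m => ((k m : ℝ) + 1) / 2) ?_ ?_
  · filter_upwards [eventually_le_of_choose_le hn hk] with m hm using hm.2.2
  · exact (tendsto_atTop_add_const_right _ 1
      (tendsto_natCast_atTop_atTop.comp hk)).atTop_div_const (by norm_num)

/-- Here k ≤ 2 n/k, so with l = n/k the product is at most 2 l² exp(-l). -/
lemma tendsto_ratio_mul_surjError (hn : ∀ m, (k m + 1).choose 2 ≤ n m)
    (hk : Tendsto k atTop atTop) :
    Tendsto (fun m => (n m : ℝ) / k m * surjError (n m) (k m)) atTop (𝓝 0) := by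
  have h1 := ((tendsto_pow_mul_exp_neg_atTop_nhds_zero 2).comp (tendsto_ratio hn hk)).const_mul 2
  rw [mul_zero] at h1
  refine squeeze_zero' (Eventually.of_forall fun m => ?_) ?_ h1
  · have := surjError_nonneg (n m) (k m); positivity
  · filter_upwards [eventually_le_of_choose_le hn hk] with m hm
    simp only [surjError, Function.comp_apply]
    calc (n m : ℝ) / k m * (k m * exp (-(n m / k m)))
        ≤ (n m : ℝ) / k m * (2 * (n m / k m) * exp (-(n m / k m))) := by
          gcongr; linarith [hm.2.2]
      _ = _ := by ring

lemma tendsto_sqrt_ratio_mul_surjError (hn : ∀ m, (k m + 1).choose 2 ≤ n m)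
    (hk : Tendsto k atTop atTop) :
    Tendsto (fun m => √((n m : ℝ) / k m) * surjError (n m) (k m)) atTop (𝓝 0) := by
  refine squeeze_zero' (Eventually.of_forall fun m => ?_) ?_ (tendsto_ratio_mul_surjError hn hk)
  · have := surjError_nonneg (n m) (k m); positivity
  · filter_upwards [(tendsto_ratio hn hk).eventually_ge_atTop 1] with m hm
    have := surjError_nonneg (n m) (k m)
    gcongr
    rw [sqrt_le_left (by linarith)]
    nlinarith

lemma tendsto_inv_natCast (hk : Tendsto k atTop atTop) :
    Tendsto (fun m => (k m : ℝ)⁻¹) atTop (𝓝 0) :=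
  (tendsto_natCast_atTop_atTop.comp hk).inv_tendsto_atTop

lemma tendsto_card_ltPairs (hk : Tendsto k atTop atTop) :
    Tendsto (fun m => ((ltPairs (k m)).card : ℝ) / k m ^ 2) atTop (𝓝 (1 / 2)) := by
  have h1 := ((tendsto_inv_natCast hk).const_sub 1).const_mul (1 / 2)
  rw [sub_zero, mul_one] at h1
  refine h1.congr' ?_
  filter_upwards [hk.eventually_ge_atTop 1] with m hm
  have hk0 : (0 : ℝ) < k m := by exact_mod_cast hm
  have h2 : (2 : ℝ) * (ltPairs (k m)).card = k m * (k m - 1) := by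
    have := congrArg (Nat.cast : ℕ → ℝ) (two_mul_card_ltPairs (k m))
    push_cast [Nat.cast_sub hm] at this
    exact this
  field_simp
  linarith

lemma tendsto_card_quads (hk : Tendsto k atTop atTop) :
    Tendsto (fun m => ((quads (k m)).card : ℝ) / k m ^ 4) atTop (𝓝 (1 / 4)) := by
  have hi := tendsto_inv_natCast hk
  have h1 := ((tendsto_card_ltPairs hk).mul
    (((hi.const_mul 2).const_sub 1).mul ((hi.const_mul 3).const_sub 1))).const_mul (1 / 2)
  norm_num at h1
  norm_num
  refine h1.congr' ?_
  filter_upwards [hk.eventually_ge_atTop 3] with m hm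
  have hk0 : (0 : ℝ) < k m := by exact_mod_cast (by omega : 0 < k m)
  have h2 : (2 : ℝ) * (quads (k m)).card
      = (ltPairs (k m)).card * ((k m - 2) * (k m - 3)) := by
    have := congrArg (Nat.cast : ℕ → ℝ) (two_mul_card_quads (k m))
    push_cast [Nat.cast_sub hm, Nat.cast_sub (by omega : 2 ≤ k m)] at this
    exact this
  field_simp
  linarith

lemma tendsto_expect (hn : ∀ m, (k m + 1).choose 2 ≤ n m) (hk : Tendsto k atTop atTop) :
    Tendsto (fun m => √((n m : ℝ) / k m) *
      (expect (surjections (n m) (k m)) equalFibrePairs / k m ^ 2)) atTop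
      (𝓝 (1 / 2 * (2 * √π)⁻¹)) := by
  refine tendsto_of_sum_approx (N := fun m => ((ltPairs (k m)).card : ℝ))
    (I := fun m => pairsIntegral 1 (n m) (k m)) (e := fun m => surjError (n m) (k m)) ?_
    (fun m => by positivity) (fun m => by positivity) (tendsto_card_ltPairs hk) ?_
    (tendsto_sqrt_ratio_mul_surjError hn hk)
  · filter_upwards [eventually_le_of_choose_le hn hk] with m hm
    rw [expect_equalFibrePairs]
    exact abs_sum_sub_card_mul_le _ _ fun p hp => abs_prob_pair_sub_le hm.1 hm.2.1 hp
  · simpa only [pow_one, pairsIntegral] using tendsto_scaled_integral 1 hk (tendsto_ratio hn hk)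

lemma tendsto_ratio_mul_sqrt_cube (hl : Tendsto (fun m => (n m : ℝ) / k m) atTop atTop) :
    Tendsto (fun m => (n m : ℝ) / k m * √(π * 5 * (k m / n m)) ^ 3) atTop (𝓝 0) := by
  have h1 : Tendsto (fun m => π * 5 * √(π * 5 * ((n m : ℝ) / k m)⁻¹)) atTop (𝓝 0) := by
    have h2 := ((continuous_sqrt.tendsto _).comp
      (hl.inv_tendsto_atTop.const_mul (π * 5))).const_mul (π * 5)
    simpa using h2
  refine h1.congr' ?_
  filter_upwards [hl.eventually_gt_atTop 0] with m hm
  rw [inv_div]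
  have h3 : √(π * 5 * (k m / n m)) ^ 3
      = (π * 5 * (k m / n m)) * √(π * 5 * (k m / n m)) := by
    rw [pow_succ, sq_sqrt (by positivity)]
  have h4 : (n m : ℝ) / k m * (k m / n m) = 1 := by
    rw [← inv_div (n m : ℝ) (k m : ℝ)]; exact mul_inv_cancel₀ hm.ne'
  rw [h3]
  linear_combination (-(π * 5 * √(π * 5 * (k m / n m)))) * h4

lemma tendsto_mainTerm (hn : ∀ m, (k m + 1).choose 2 ≤ n m) (hk : Tendsto k atTop atTop) :
    Tendsto (fun m => (n m : ℝ) / k m * (secondMomentMainTerm (n m) (k m) / k m ^ 4)) atTop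
      (𝓝 (1 / 4 * (2 * √π)⁻¹ ^ 2)) := by
  refine tendsto_of_sum_approx (N := fun m => ((quads (k m)).card : ℝ))
    (I := fun m => pairsIntegral 2 (n m) (k m))
    (e := fun m => 2 * surjError (n m) (k m) + √(π * 5 * (k m / n m)) ^ 3) ?_
    (fun m => by positivity) (fun m => by positivity) (tendsto_card_quads hk) ?_ ?_
  · filter_upwards [eventually_le_of_choose_le hn hk, hk.eventually_ge_atTop 5] with m hm hm5
    rw [secondMomentMainTerm_eq]
    exact abs_sum_sub_card_mul_le _ _ fun p hp => abs_prob_quad_sub_le hm5 hm.2.1 hp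
  · refine (tendsto_scaled_integral 2 hk (tendsto_ratio hn hk)).congr fun m => ?_
    rw [sq_sqrt (by positivity), pairsIntegral]
  · have h := ((tendsto_ratio_mul_surjError hn hk).const_mul 2).add
      (tendsto_ratio_mul_sqrt_cube (tendsto_ratio hn hk))
    rw [mul_zero, add_zero] at h
    refine h.congr fun m => ?_
    ring

/-- Relative to k⁵/n, the three remaining parts have orders √(n/k⁵), 1/k and √(k/n), up to
surjection errors; `hE`, `hO` and `hQ` treat them in this order. -/
lemma tendsto_denominator_sub (hn : ∀ m, (k m + 1).choose 2 ≤ n m) (hk : Tendsto k atTop atTop)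
    (hnk : Tendsto (fun m => (n m : ℝ) / (k m : ℝ) ^ 5) atTop (𝓝 0)) :
    Tendsto (fun m => (n m : ℝ) / k m *
      ((secondMomentDenominator (n m) (k m) - secondMomentMainTerm (n m) (k m)) / k m ^ 4)) atTop
      (𝓝 0) := by
  have hl := tendsto_ratio hn hk
  have hE : Tendsto (fun m => √((n m : ℝ) / k m) *
      (expect (surjections (n m) (k m)) equalFibrePairs / k m ^ 2) * √((n m : ℝ) / (k m : ℝ) ^ 5))
      atTop (𝓝 0) := by
    have h1 := (tendsto_expect hn hk).mul ((continuous_sqrt.tendsto _).comp hnk)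
    rw [sqrt_zero, mul_zero] at h1
    exact h1
  have hO : Tendsto (fun m => (k m : ℝ)⁻¹ * (π * 4 + (n m : ℝ) / k m * surjError (n m) (k m))) atTop
      (𝓝 0) := by
    simpa using (tendsto_inv_natCast hk).mul ((tendsto_ratio_mul_surjError hn hk).const_add (π * 4))
  have hQ : Tendsto (fun m => ((quads (k m)).card : ℝ) / k m ^ 4 *
      ((n m : ℝ) / k m * √(π * 5 * (k m / n m)) ^ 3 + (n m : ℝ) / k m * surjError (n m) (k m))) atTop
      (𝓝 0) := by
    simpa using (tendsto_card_quads hk).mul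
      ((tendsto_ratio_mul_sqrt_cube hl).add (tendsto_ratio_mul_surjError hn hk))
  have hsum := hE.add (hO.add hQ)
  rw [add_zero, add_zero] at hsum
  refine squeeze_zero' (Eventually.of_forall fun m => ?_) ?_ hsum
  · have := secondMomentDenominator_sub_nonneg (n m) (k m)
    positivity
  filter_upwards [eventually_le_of_choose_le hn hk, hk.eventually_ge_atTop 5] with m hm hm5
  obtain ⟨-, hkn, -⟩ := hm
  have hk0 : (0 : ℝ) < k m := by exact_mod_cast (by omega : 0 < k m)
  have hn0 : (0 : ℝ) < n m := by exact_mod_cast (by omega : 0 < n m)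
  have herr := surjError_nonneg (n m) (k m)
  have hO1 : ∑ c ∈ (overlaps (k m)).filter (fun c => c.1 ≠ c.2),
      prob (surjections (n m) (k m)) (AllEqual c)
      ≤ k m ^ 3 * (π * 4 * (k m / n m) + surjError (n m) (k m)) := by
    have h1 : ∀ c ∈ (overlaps (k m)).filter (fun c => c.1 ≠ c.2),
        prob (surjections (n m) (k m)) (AllEqual c)
          ≤ π * 4 * (k m / n m) + surjError (n m) (k m) := by
      intro c hc
      have h2 := prob_allEqual_of_overlap (n := n m) (by omega) (by omega) hc
      rw [sq_sqrt (by positivity)] at h2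
      have h3 := (abs_le.1 (abs_prob_surjections_sub_le (by omega) hkn (AllEqual (n := n m) c))).2
      unfold surjError
      linarith
    refine (Finset.sum_le_card_nsmul _ _ _ h1).trans ?_
    rw [nsmul_eq_mul]
    gcongr
    exact_mod_cast (Finset.card_filter_le _ _).trans (card_overlaps_le (k m))
  have hQ1 : ∑ c ∈ quads (k m), prob (surjections (n m) (k m)) (AllEqual c)
      ≤ (quads (k m)).card * (√(π * 5 * (k m / n m)) ^ 3 + surjError (n m) (k m)) := by
    rw [← nsmul_eq_mul]
    refine Finset.sum_le_card_nsmul _ _ _ fun c hc => ?_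
    have h2 := prob_allEqual_of_quad (n := n m) (by omega) hm5 hc
    have h3 := (abs_le.1 (abs_prob_surjections_sub_le (by omega) hkn (AllEqual (n := n m) c))).2
    unfold surjError
    linarith
  have hsq : √((n m : ℝ) / k m) * √((n m : ℝ) / (k m : ℝ) ^ 5) = n m / k m / k m ^ 2 := by
    rw [← sqrt_mul (by positivity),
      show (n m : ℝ) / k m * (n m / k m ^ 5) = (n m / k m / k m ^ 2) ^ 2 by field_simp,
      sqrt_sq (by positivity)]
  have hD := (secondMomentDenominator_sub_le (n m) (k m)).trans
    (add_le_add_right (add_le_add hO1 hQ1) _)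
  calc (n m : ℝ) / k m *
        ((secondMomentDenominator (n m) (k m) - secondMomentMainTerm (n m) (k m)) / k m ^ 4)
      ≤ (n m : ℝ) / k m * ((expect (surjections (n m) (k m)) equalFibrePairs
        + (k m ^ 3 * (π * 4 * (k m / n m) + surjError (n m) (k m)) + (quads (k m)).card *
          (√(π * 5 * (k m / n m)) ^ 3 + surjError (n m) (k m)))) / k m ^ 4) := by gcongr
    _ = (√((n m : ℝ) / k m) * √((n m : ℝ) / (k m : ℝ) ^ 5)) *
          (expect (surjections (n m) (k m)) equalFibrePairs / k m ^ 2)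
        + ((k m : ℝ)⁻¹ * (π * 4 + (n m : ℝ) / k m * surjError (n m) (k m))
        + ((quads (k m)).card : ℝ) / k m ^ 4 * ((n m : ℝ) / k m * √(π * 5 * (k m / n m)) ^ 3
          + (n m : ℝ) / k m * surjError (n m) (k m))) := by
        rw [hsq]; field_simp
    _ = _ := by ring

/-- As n ≥ 1, a bounded k would keep n/k⁵ away from 0. -/
lemma tendsto_atTop_of_ratio (h1 : ∀ m, 1 ≤ k m) (hkn : ∀ m, 1 ≤ n m)
    (hnk : Tendsto (fun m => (n m : ℝ) / (k m : ℝ) ^ 5) atTop (𝓝 0)) : Tendsto k atTop atTop := by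
  refine tendsto_atTop.2 fun b => ?_
  have hb : (0 : ℝ) < 1 / ((b : ℝ) + 1) ^ 5 := by positivity
  filter_upwards [hnk.eventually_lt_const hb] with m hm
  by_contra hlt
  push Not at hlt
  have hk0 : (0 : ℝ) < k m := by exact_mod_cast h1 m
  have hn1 : (1 : ℝ) ≤ n m := by exact_mod_cast hkn m
  have hkb : (k m : ℝ) ≤ b + 1 := by exact_mod_cast (by omega : k m ≤ b + 1)
  have : 1 / ((b : ℝ) + 1) ^ 5 ≤ n m / (k m : ℝ) ^ 5 := by gcongr
  linarith

lemma one_le_of_choose_le (hn : ∀ m, (k m + 1).choose 2 ≤ n m) (h1 : ∀ m, 1 ≤ k m) (m : ℕ) :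
    1 ≤ n m :=
  le_trans (Nat.choose_pos (by have := h1 m; omega)) (hn m)

lemma isEquivalent_expect (hn : ∀ m, (k m + 1).choose 2 ≤ n m) (hk : Tendsto k atTop atTop) :
    (fun m => expect (surjections (n m) (k m)) equalFibrePairs) ~[atTop]
      (fun m => (k m : ℝ) ^ 2 / 4 * √((k m : ℝ) / (π * (n m : ℝ)))) := by
  have hpi := pi_pos
  have hev := eventually_le_of_choose_le hn hk
  rw [isEquivalent_iff_tendsto_one]
  · have h := (tendsto_expect hn hk).const_mul (4 * √π)
    rw [show 4 * √π * (1 / 2 * (2 * √π)⁻¹) = 1 by field_simp; norm_num] at h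
    refine h.congr' ?_
    filter_upwards [hev] with m hm
    have hk0 : (0 : ℝ) < k m := by exact_mod_cast hm.1
    have hn0 : (0 : ℝ) < n m := by exact_mod_cast (by omega : 0 < n m)
    simp only [Pi.div_apply]
    rw [sqrt_div hk0.le, sqrt_div hn0.le, sqrt_mul hpi.le]
    field_simp
  · filter_upwards [hev] with m hm
    have hk0 : (0 : ℝ) < k m := by exact_mod_cast hm.1
    have hn0 : (0 : ℝ) < n m := by exact_mod_cast (by omega : 0 < n m)
    positivity

lemma isEquivalent_mainTerm (hn : ∀ m, (k m + 1).choose 2 ≤ n m) (hk : Tendsto k atTop atTop) :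
    (fun m => secondMomentMainTerm (n m) (k m)) ~[atTop]
      (fun m => (k m : ℝ) ^ 5 / (16 * π * (n m : ℝ))) := by
  have hpi := pi_pos
  have hev := eventually_le_of_choose_le hn hk
  rw [isEquivalent_iff_tendsto_one]
  · have h := (tendsto_mainTerm hn hk).const_mul (16 * π)
    rw [show 16 * π * (1 / 4 * (2 * √π)⁻¹ ^ 2) = 1 by
      rw [inv_pow, mul_pow, sq_sqrt hpi.le]; field_simp; norm_num] at h
    refine h.congr' ?_
    filter_upwards [hev] with m hm
    have hk0 : (0 : ℝ) < k m := by exact_mod_cast hm.1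
    have hn0 : (0 : ℝ) < n m := by exact_mod_cast (by omega : 0 < n m)
    simp only [Pi.div_apply]
    field_simp
  · filter_upwards [hev] with m hm
    have hk0 : (0 : ℝ) < k m := by exact_mod_cast hm.1
    have hn0 : (0 : ℝ) < n m := by exact_mod_cast (by omega : 0 < n m)
    positivity

lemma isEquivalent_denominator (hn : ∀ m, (k m + 1).choose 2 ≤ n m) (hk : Tendsto k atTop atTop)
    (hnk : Tendsto (fun m => (n m : ℝ) / (k m : ℝ) ^ 5) atTop (𝓝 0)) :
    (fun m => secondMomentDenominator (n m) (k m)) ~[atTop]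
      (fun m => secondMomentMainTerm (n m) (k m)) := by
  have hpi := pi_pos
  have hM := tendsto_mainTerm hn hk
  have hpos : (0 : ℝ) < 1 / 4 * (2 * √π)⁻¹ ^ 2 := by positivity
  have hratio := (tendsto_denominator_sub hn hk hnk).div hM hpos.ne'
  rw [zero_div] at hratio
  unfold IsEquivalent
  refine (isLittleO_iff_tendsto' ?_).2 (hratio.congr' ?_)
  · filter_upwards [hM.eventually_const_lt hpos] with m hm h0
    simp [h0] at hm
  · filter_upwards [hM.eventually_const_lt hpos] with m hm
    have hne : (n m : ℝ) / k m ≠ 0 := fun h => by simp [h] at hm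
    have hk0 : (k m : ℝ) ^ 4 ≠ 0 := fun h => by simp [h] at hm
    simp only [Pi.sub_apply, Pi.div_apply]
    rw [mul_div_mul_left _ _ hne, div_div_div_cancel_right₀ hk0]

/-- After scaling, (E X)² and E X² have the same limit 1/(16π), so Cauchy–Schwarz forces P(X > 0) →
1. -/
lemma tendsto_prob_one_of_choose_le (hn : ∀ m, (k m + 1).choose 2 ≤ n m)
    (hk : Tendsto k atTop atTop)
    (hnk : Tendsto (fun m => (n m : ℝ) / (k m : ℝ) ^ 5) atTop (𝓝 0)) :
    Tendsto (fun m => prob (surjections (n m) (k m)) HasEqualFibres) atTop (𝓝 1) := by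
  have hpi := pi_pos
  have hE := (tendsto_expect hn hk).pow 2
  have hD := (tendsto_denominator_sub hn hk hnk).add (tendsto_mainTerm hn hk)
  have hpos : (0 : ℝ) < 1 / 4 * (2 * √π)⁻¹ ^ 2 := by positivity
  rw [zero_add] at hD
  have hratio := hE.div hD hpos.ne'
  rw [show (1 / 2 * (2 * √π)⁻¹) ^ 2 / (1 / 4 * (2 * √π)⁻¹ ^ 2) = 1 by
    rw [div_eq_one_iff_eq hpos.ne']; ring] at hratio
  refine tendsto_of_tendsto_of_tendsto_of_le_of_le' hratio tendsto_const_nhds ?_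
    (Eventually.of_forall fun m => prob_le_one _ _)
  filter_upwards [hD.eventually_const_lt hpos] with m hm
  have h1 := sq_expect_le (surjections (n m) (k m)) equalFibrePairs
  rw [← secondMomentDenominator_eq, prob_congr fun f _ => equalFibrePairs_pos_iff f] at h1
  simp only [Pi.div_apply]
  rw [div_le_iff₀ hm, mul_pow, sq_sqrt (by positivity), div_pow]
  calc (n m : ℝ) / k m * (expect (surjections (n m) (k m)) equalFibrePairs ^ 2 / (k m ^ 2) ^ 2)
      ≤ (n m : ℝ) / k m * (prob (surjections (n m) (k m)) HasEqualFibres *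
          secondMomentDenominator (n m) (k m) / (k m ^ 2) ^ 2) := by gcongr
    _ = _ := by ring

lemma tendsto_prob_one (h : ∀ m, 1 ≤ k m ∧ k m ≤ n m)
    (hnk : Tendsto (fun m => (n m : ℝ) / (k m : ℝ) ^ 5) atTop (𝓝 0)) :
    Tendsto (fun m => prob (surjections (n m) (k m)) HasEqualFibres) atTop (𝓝 1) := by
  have hk : Tendsto k atTop atTop :=
    tendsto_atTop_of_ratio (fun m => (h m).1) (fun m => (h m).1.trans (h m).2) hnk
  -- The sequence may alternate between n below and above C(k+1,2). Raising n to `N` reaches the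
  -- second-moment regime, with N/k⁵ → 0 still; where n was raised, the original probability is
  -- already 1.
  set N : ℕ → ℕ := fun m => max (n m) ((k m + 1).choose 2) with hN
  have hNk : Tendsto (fun m => (N m : ℝ) / (k m : ℝ) ^ 5) atTop (𝓝 0) := by
    have hsum := hnk.add (tendsto_inv_natCast hk)
    rw [add_zero] at hsum
    refine squeeze_zero (fun m => by positivity) (fun m => ?_) hsum
    have hk1 : (1 : ℝ) ≤ k m := by exact_mod_cast (h m).1
    have hc : ((k m + 1).choose 2 : ℝ) ≤ k m ^ 2 := by
      have h1 : (k m + 1).choose 2 ≤ k m ^ 2 := by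
        rw [Nat.choose_two_right, Nat.add_sub_cancel]
        refine Nat.div_le_of_le_mul ?_
        have := (h m).1
        nlinarith
      exact_mod_cast h1
    have hN1 : (N m : ℝ) ≤ n m + k m ^ 2 := by
      simp only [hN, Nat.cast_max]
      refine max_le (by nlinarith) ?_
      have : (0 : ℝ) ≤ n m := Nat.cast_nonneg _
      linarith
    calc (N m : ℝ) / (k m : ℝ) ^ 5 ≤ (n m + k m ^ 2) / (k m : ℝ) ^ 5 := by gcongr
      _ = n m / (k m : ℝ) ^ 5 + k m ^ 2 / (k m : ℝ) ^ 5 := add_div _ _ _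
      _ ≤ n m / (k m : ℝ) ^ 5 + (k m : ℝ)⁻¹ := by
          gcongr
          rw [div_le_iff₀ (by positivity)]
          have : (k m : ℝ)⁻¹ * k m ^ 5 = k m ^ 4 := by field_simp
          rw [this]
          exact pow_le_pow_right₀ hk1 (by norm_num)
  have hlim := tendsto_prob_one_of_choose_le (fun m => le_max_right _ _ : ∀ m, _ ≤ N m) hk hNk
  refine tendsto_of_tendsto_of_tendsto_of_le_of_le hlim tendsto_const_nhds (fun m => ?_)
    fun m => prob_le_one _ _
  by_cases hlt : n m < (k m + 1).choose 2
  · simp only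
    rw [prob_eq_one (p := HasEqualFibres) (surjections_nonempty (h m).1 (h m).2)
      fun f hf => hasEqualFibres_of_lt hlt hf]
    exact prob_le_one _ _
  · have : N m = n m := max_eq_left (by omega)
    change prob (surjections (N m) (k m)) HasEqualFibres
      ≤ prob (surjections (n m) (k m)) HasEqualFibres
    rw [this]

lemma tendsto_prob_zero (h : ∀ m, 1 ≤ k m ∧ k m ≤ n m)
    (hnk : Tendsto (fun m => (n m : ℝ) / (k m : ℝ) ^ 5) atTop atTop) :
    Tendsto (fun m => prob (surjections (n m) (k m)) HasEqualFibres) atTop (𝓝 0) := by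
  have hpi := pi_pos
  have hinv := hnk.inv_tendsto_atTop
  have h1 : Tendsto (fun m => √(π * 3 * ((n m : ℝ) / (k m : ℝ) ^ 5)⁻¹)
      + ((n m : ℝ) / (k m : ℝ) ^ 5)⁻¹) atTop (𝓝 0) := by
    have h2 := ((continuous_sqrt.tendsto _).comp (hinv.const_mul (π * 3))).add hinv
    simpa using h2
  refine squeeze_zero (fun m => prob_nonneg _ _) (fun m => ?_) h1
  obtain ⟨hk1, hkn⟩ := h m
  have hk0 : (0 : ℝ) < k m := by exact_mod_cast hk1
  have hk1' : (1 : ℝ) ≤ k m := by exact_mod_cast hk1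
  have hn0 : (0 : ℝ) < n m := by exact_mod_cast (by omega : 0 < n m)
  have hcard : ((ltPairs (k m)).card : ℝ) ≤ k m ^ 2 := by
    have h2 := two_mul_card_ltPairs (k m)
    have h3 : k m * (k m - 1) ≤ k m * k m := Nat.mul_le_mul_left _ (by omega)
    exact_mod_cast (by nlinarith : (ltPairs (k m)).card ≤ k m ^ 2)
  -- The crude exp(-x) ≤ 1/x suffices: over at most k² pairs the error sums to k⁴/n ≤ k⁵/n.
  have hexp : surjError (n m) (k m) ≤ k m * (k m / n m) := by
    unfold surjError
    gcongr
    rw [exp_neg, ← inv_div (n m : ℝ) (k m : ℝ)]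
    gcongr
    linarith [add_one_le_exp ((n m : ℝ) / k m)]
  have hpair : ∀ p ∈ ltPairs (k m), prob (surjections (n m) (k m))
      (fun f => fibreSize f p.1 = fibreSize f p.2)
      ≤ √(π * 3 * (k m / n m)) + k m * (k m / n m) := by
    intro p hp
    have h2 := prob_pair_le (n := n m) (by omega) (mem_ltPairs.1 hp)
    have h3 := (abs_le.1 (abs_prob_surjections_sub_le hk1 hkn
      (fun f : Fin (n m) → Fin (k m) => fibreSize f p.1 = fibreSize f p.2))).2
    unfold surjError at hexp
    linarith
  calc prob (surjections (n m) (k m)) HasEqualFibres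
      ≤ ∑ p ∈ ltPairs (k m), prob (surjections (n m) (k m))
          (fun f => fibreSize f p.1 = fibreSize f p.2) := by
        refine le_trans (prob_mono fun f _ hf => ?_) (prob_exists_le _ _ _)
        obtain ⟨i, j, hij, he⟩ := hf
        exact ⟨(i, j), mem_ltPairs.2 hij, he⟩
    _ ≤ (ltPairs (k m)).card * (√(π * 3 * (k m / n m)) + k m * (k m / n m)) := by
        rw [← nsmul_eq_mul]
        exact Finset.sum_le_card_nsmul _ _ _ hpair
    _ ≤ k m ^ 2 * (√(π * 3 * (k m / n m)) + k m * (k m / n m)) := by gcongr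
    _ = k m ^ 2 * √(π * 3 * (k m / n m)) + k m ^ 4 / n m := by ring
    _ ≤ _ := by
        rw [inv_div]
        refine add_le_add (le_of_eq ?_) ?_
        · rw [show π * 3 * ((k m : ℝ) ^ 5 / n m) = (k m ^ 2) ^ 2 * (π * 3 * (k m / n m)) by ring,
            sqrt_mul (sq_nonneg ((k m : ℝ) ^ 2)), sqrt_sq (by positivity)]
        · gcongr
          norm_num

end Regime

end EqualParts

end

theorem mainTheorem3 :
    -- `n / k ^ 5 → ∞`: almost surely no two fibres (blocks) have the same size
    (∀ n k : ℕ → ℕ, (∀ m, 1 ≤ k m ∧ k m ≤ n m) →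
      Tendsto (fun m => (n m : ℝ) / (k m : ℝ) ^ 5) atTop atTop →
        Tendsto (fun m => EqualParts.prob (EqualParts.surjections (n m) (k m))
          EqualParts.HasEqualFibres) atTop (𝓝 0) ∧
        Tendsto (fun m => EqualParts.prob (EqualParts.setPartitions (n m) (k m))
          EqualParts.HasEqualBlocks) atTop (𝓝 0)) ∧
    -- `n / k ^ 5 → 0`: almost surely some two fibres (blocks) have the same size
    (∀ n k : ℕ → ℕ, (∀ m, 1 ≤ k m ∧ k m ≤ n m) →
      Tendsto (fun m => (n m : ℝ) / (k m : ℝ) ^ 5) atTop (𝓝 0) →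
        Tendsto (fun m => EqualParts.prob (EqualParts.surjections (n m) (k m))
          EqualParts.HasEqualFibres) atTop (𝓝 1) ∧
        Tendsto (fun m => EqualParts.prob (EqualParts.setPartitions (n m) (k m))
          EqualParts.HasEqualBlocks) atTop (𝓝 1)) ∧
    -- the expected number of pairs of equal size, and the main second-moment term
    (∀ n k : ℕ → ℕ, (∀ m, (k m + 1).choose 2 ≤ n m) → Tendsto k atTop atTop →
        (fun m => EqualParts.expect (EqualParts.surjections (n m) (k m))
          EqualParts.equalFibrePairs) ~[atTop]
          (fun m => (k m : ℝ) ^ 2 / 4 * √((k m : ℝ) / (Real.pi * (n m : ℝ)))) ∧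
        (fun m => EqualParts.expect (EqualParts.setPartitions (n m) (k m))
          EqualParts.equalBlockPairs) ~[atTop]
          (fun m => (k m : ℝ) ^ 2 / 4 * √((k m : ℝ) / (Real.pi * (n m : ℝ)))) ∧
        (fun m => EqualParts.secondMomentMainTerm (n m) (k m)) ~[atTop]
          (fun m => (k m : ℝ) ^ 5 / (16 * Real.pi * (n m : ℝ)))) ∧
    -- when `n / k ^ 5 → 0` the other terms of the denominator are negligible
    (∀ n k : ℕ → ℕ, (∀ m, (k m + 1).choose 2 ≤ n m) → (∀ m, 1 ≤ k m) →
      Tendsto (fun m => (n m : ℝ) / (k m : ℝ) ^ 5) atTop (𝓝 0) →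
        (fun m => EqualParts.secondMomentDenominator (n m) (k m)) ~[atTop]
          (fun m => EqualParts.secondMomentMainTerm (n m) (k m))) := by
  refine ⟨fun n k h hnk => ?_, fun n k h hnk => ?_, fun n k hn hk => ?_,
    fun n k hn h1 hnk => ?_⟩
  · simp only [EqualParts.prob_hasEqualBlocks]
    exact ⟨EqualParts.tendsto_prob_zero h hnk, EqualParts.tendsto_prob_zero h hnk⟩
  · simp only [EqualParts.prob_hasEqualBlocks]
    exact ⟨EqualParts.tendsto_prob_one h hnk, EqualParts.tendsto_prob_one h hnk⟩
  · simp only [EqualParts.expect_equalBlockPairs]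
    exact ⟨EqualParts.isEquivalent_expect hn hk, EqualParts.isEquivalent_expect hn hk,
      EqualParts.isEquivalent_mainTerm hn hk⟩
  · exact EqualParts.isEquivalent_denominator hn (EqualParts.tendsto_atTop_of_ratio h1
      (EqualParts.one_le_of_choose_le hn h1) hnk) hnk
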